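/- For a bounded operator $T$ between complex Hilbert spaces let $s_j(T)=\inf\{\|T-R\|:\operatorname{rank}R\le j\}$, $j\ge 0$, be its singular values. Write $T\in\boldsymbol S_1$ (trace class) if $\|T\|_{\boldsymbol S_1}=\sum_{j\ge0}s_j(T)<\infty$, and $T\in\boldsymbol S_\Omega$ if $$\|T\|_{\boldsymbol S_\Omega}=\sup_{n\ge0}\frac{1}{\log(2+n)}\sum_{j=0}^{n}s_j(T)<\infty .$$ For a Lipschitz function $f:\mathbb R\to\mathbb C$ put $\|f\|_{\rm Lip}=\sup_{x\ne y}\frac{|f(x)-f(y)|}{|x-y|}$, and let $(\mathfrak D f)(x,y)=\frac{f(x)-f(y)}{x-y}$ for $x\neq y$ and $(\mathfrak D f)(x,x)=0$. Let $E_1$ and $E_2$ be Borel spectral measures on $\mathbb R$ (strongly countably additive, with values orthogonal projections, $E_i(\mathbb R)=I$) on complex Hilbert spaces $H_1$ and $H_2$, and let $T:H_2\to H_1$ be bounded. A bounded operator $Q:H_2\to H_1$ is the double operator integral $$\mathcal I_{E_1,E_2}(f,T)=\iint \frac{f(x)-f(y)}{x-y}\,dE_1(x)\,T\,dE_2(y)$$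 if for all $u\in H_2$, $v\in H_1$ there is a complex Borel measure $\mu_{u,v}$ on $\mathbb R^2$ with $\mu_{u,v}(A\times B)=\langle E_1(A)TE_2(B)u,v\rangle$ for all Borel sets $A,B\subset\mathbb R$ and $\langle Qu,v\rangle=\int \mathfrak D f\,d\mu_{u,v}$. **Theorem.** There is an absolute constant $C$ such that the following holds. Let $f$ be a Lipschitz function on $\mathbb R$, let $E_1$ and $E_2$ be Borel spectral measures on $\mathbb R$ on complex Hilbert spaces $H_1$ and $H_2$, and let $T:H_2\to H_1$ belong to $\boldsymbol S_1$. Then the double operator integral $\mathcal I_{E_1,E_2}(f,T)$ exists and is unique, it belongs to $\boldsymbol S_\Omega$, and $$\|\mathcal I_{E_1,E_2}(f,T)\|_{\boldsymbol S_\Omega}\le C\,\|f\|_{\rm Lip}\,\|T\|_{\boldsymbol S_1}.$$ -/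

import Mathlib

open MeasureTheory

noncomputable section

namespace LipschitzDOI

/-- A Borel spectral measure on `ℝ` acting in the Hilbert space `H`: a map from Borel sets to
orthogonal projections with `E ℝ = 1`, multiplicative on intersections, and countably additive in
the strong operator topology. The values on non-measurable sets play no role. -/
structure SpectralMeasure (H : Type*) [NormedAddCommGroup H] [InnerProductSpace ℂ H]
    [CompleteSpace H] where
  /-- the projection attached to a set -/
  proj : Set ℝ → (H →L[ℂ] H)
  isStarProjection : ∀ A, MeasurableSet A → IsStarProjection (proj A)
  proj_univ : proj Set.univ = 1
  proj_inter : ∀ A B, MeasurableSet A → MeasurableSet B → proj (A ∩ B) = proj A * proj B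
  hasSum_proj : ∀ A : ℕ → Set ℝ, (∀ i, MeasurableSet (A i)) →
    Pairwise (fun i j => Disjoint (A i) (A j)) →
    ∀ x : H, HasSum (fun i => proj (A i) x) (proj (⋃ i, A i) x)

section Ideals

variable {H₁ H₂ : Type*} [NormedAddCommGroup H₁] [InnerProductSpace ℂ H₁]
  [NormedAddCommGroup H₂] [InnerProductSpace ℂ H₂]

/-- The singular value `s_j(T)`: the distance in operator norm from `T` to the set of bounded
operators of rank at most `j`. -/
def singularValue (T : H₂ →L[ℂ] H₁) (j : ℕ) : ℝ :=
  sInf {r : ℝ | ∃ R : H₂ →L[ℂ] H₁, (R : H₂ →ₗ[ℂ] H₁).rank ≤ (j : Cardinal) ∧ r = ‖T - R‖}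

/-- `T` belongs to the trace class `S₁`. -/
def IsTraceClass (T : H₂ →L[ℂ] H₁) : Prop :=
  Summable (singularValue T)

/-- The norm of `S₁`. -/
def traceNorm (T : H₂ →L[ℂ] H₁) : ℝ :=
  ∑' j, singularValue T j

/-- The quotient `(log (2 + n))⁻¹ * ∑_{j = 0}^{n} s_j(T)`. -/
def logMean (T : H₂ →L[ℂ] H₁) (n : ℕ) : ℝ :=
  (Real.log (2 + n))⁻¹ * ∑ j ∈ Finset.range (n + 1), singularValue T j

/-- `T` belongs to `S_Ω`. -/
def MemSOmega (T : H₂ →L[ℂ] H₁) : Prop :=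
  BddAbove (Set.range (logMean T))

/-- The norm of `S_Ω`. -/
def sOmegaNorm (T : H₂ →L[ℂ] H₁) : ℝ :=
  ⨆ n : ℕ, logMean T n

end Ideals

/-- The Lipschitz seminorm: the supremum of `|f(x) - f(y)| / |x - y|` over `x ≠ y`. -/
def lipNorm (f : ℝ → ℂ) : ℝ :=
  ⨆ p : {p : ℝ × ℝ // p.1 ≠ p.2}, ‖f p.1.1 - f p.1.2‖ / |p.1.1 - p.1.2|

open Classical in
/-- The divided difference of `f`, equal to zero on the diagonal. -/
def dividedDiff (f : ℝ → ℂ) (z : ℝ × ℝ) : ℂ :=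
  if z.1 = z.2 then 0 else (f z.1 - f z.2) / ((z.1 - z.2 : ℝ) : ℂ)

/-- `Q` is the double operator integral `∬ Φ(x, y) dE₁(x) T dE₂(y)`.

For Hilbert-Schmidt `T` (in particular for `T` of trace class), the set function
`A × B ↦ E₁(A) T E₂(B)` extends to a countably additive measure on the Borel sets of `ℝ²`
with values in the Hilbert-Schmidt class, and the double operator integral is the integral of the
bounded Borel function `Φ` against it. We state this through matrix elements: for all vectors
`u`, `v`, the number `⟪v, Q u⟫` is the integral of `Φ` against the complex Borel measure on
`ℝ²` (unique, as it is prescribed on rectangles) given by `A × B ↦ ⟪v, E₁(A) T E₂(B) u⟫`. -/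
def IsDoubleOperatorIntegral {H₁ H₂ : Type*}
    [NormedAddCommGroup H₁] [InnerProductSpace ℂ H₁] [CompleteSpace H₁]
    [NormedAddCommGroup H₂] [InnerProductSpace ℂ H₂] [CompleteSpace H₂]
    (E₁ : SpectralMeasure H₁) (E₂ : SpectralMeasure H₂) (Φ : ℝ × ℝ → ℂ)
    (T Q : H₂ →L[ℂ] H₁) : Prop :=
  ∀ (u : H₂) (v : H₁), ∃ μ : ComplexMeasure (ℝ × ℝ),
    (∀ A B : Set ℝ, MeasurableSet A → MeasurableSet B →
      μ (A ×ˢ B) = inner ℂ v (E₁.proj A (T (E₂.proj B u)))) ∧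
    μ.Integrable Φ ∧
    inner ℂ v (Q u) = VectorMeasure.integral μ Φ (ContinuousLinearMap.mul ℝ ℂ)

end LipschitzDOI

end

noncomputable section

namespace LipschitzDOI

/-! ### Divided differences -/

section DividedDifference

variable {f : ℝ → ℂ} {L : ℝ}

/-! The size of `Q` is measured by the matrix sums `∑ ‖⟪e i, Q (g i)⟫‖` over orthonormal families of
length `m`. They are subadditive in `Q`, pass to weak limits, and control the first singular values
up to a factor 4 (`sum_singularValue_le_of_forall`). A trace class `T` is an absolutely convergent
sum of rank one operators with coefficients adding up to at most `26 * traceNorm T`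
(`exists_hasSum_rankOne`), so it suffices to bound the matrix sums by a multiple of `L * log (1 +
m)` when `T` has rank one.

For such `T`, with the spectral measures discretised by a simple function, the operator has kernel
`dividedDiff f` on a product of two finite weighted sets of mass at most one. The core is
`exists_kernel_approx`: a kernel of rank `O(N)` lies within squared Hilbert-Schmidt distance `O(L ^
2 / N)`. The line is cut into `O(N)` cells that are single points or have mass at most `1 / N`;
diagonal blocks are dropped, and in every other block the variable with the shorter cell is frozen
at the left end. If that cell has length `ℓ`, the error is at most `2 * L * min 1 (ℓ / |x - y|)`.
The other cells being at least `ℓ` long, their distances on either side are `ℓ`-separated, so the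
squared errors sum to `O(L ^ 2)` times the mass of a cell.

Each dyadic scale of `N` then contributes `O(L)` to the matrix sum, and only about `log m` scales
matter (`sum_norm_inner_le_log`).

Dominated convergence against the measure prescribed on rectangles shows that the matrix elements of
the discretised operators converge. The uniform bound yields an operator as the weak limit, and
uniqueness holds because the limit determines all matrix elements. -/

lemma dividedDiff_self (f : ℝ → ℂ) (x : ℝ) : dividedDiff f (x, x) = 0 := by
  simp [dividedDiff]

lemma dividedDiff_of_ne (f : ℝ → ℂ) {x y : ℝ} (h : x ≠ y) :
    dividedDiff f (x, y) = (f x - f y) / ((x - y : ℝ) : ℂ) := by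
  simp [dividedDiff, h]

lemma dividedDiff_comm (f : ℝ → ℂ) (x y : ℝ) : dividedDiff f (x, y) = dividedDiff f (y, x) := by
  rcases eq_or_ne x y with rfl | h
  · rfl
  · rw [dividedDiff_of_ne f h, dividedDiff_of_ne f h.symm, ← neg_sub (f y), ← neg_sub y x,
      Complex.ofReal_neg, neg_div_neg_eq]

lemma norm_dividedDiff_le (hL : 0 ≤ L) (hf : ∀ x y, ‖f x - f y‖ ≤ L * |x - y|) (x y : ℝ) :
    ‖dividedDiff f (x, y)‖ ≤ L := by
  rcases eq_or_ne x y with rfl | h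
  · simpa [dividedDiff_self] using hL
  · rw [dividedDiff_of_ne f h, norm_div, Complex.norm_real, Real.norm_eq_abs]
    exact div_le_of_le_mul₀ (abs_nonneg _) hL (hf x y)

lemma norm_dividedDiff_sub_le_two_mul (hL : 0 ≤ L) (hf : ∀ x y, ‖f x - f y‖ ≤ L * |x - y|)
    (x y c : ℝ) : ‖dividedDiff f (x, y) - dividedDiff f (c, y)‖ ≤ 2 * L := by
  have h1 := norm_dividedDiff_le hL hf x y
  have h2 := norm_dividedDiff_le hL hf c y
  have h3 := norm_sub_le (dividedDiff f (x, y)) (dividedDiff f (c, y))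
  linarith

/-- Multiplying the difference by `x - y` leaves `(f x - f c) - dividedDiff f (c, y) * (x - c)`, and
both terms are Lipschitz in `x - c`. -/
lemma norm_dividedDiff_sub_mul_le (hL : 0 ≤ L) (hf : ∀ x y, ‖f x - f y‖ ≤ L * |x - y|)
    {x y c : ℝ} (hc : c ≠ y) :
    ‖dividedDiff f (x, y) - dividedDiff f (c, y)‖ * |x - y| ≤ 2 * L * |x - c| := by
  rcases eq_or_ne x y with rfl | hx
  · simp only [sub_self, abs_zero, mul_zero]
    positivity
  have hxy : ((x - y : ℝ) : ℂ) ≠ 0 := by exact_mod_cast sub_ne_zero.2 hx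
  have hcy : ((c - y : ℝ) : ℂ) ≠ 0 := by exact_mod_cast sub_ne_zero.2 hc
  have key : (dividedDiff f (x, y) - dividedDiff f (c, y)) * ((x - y : ℝ) : ℂ) =
      (f x - f c) - dividedDiff f (c, y) * ((x - c : ℝ) : ℂ) := by
    rw [dividedDiff_of_ne f hx, dividedDiff_of_ne f hc]
    field_simp
    push_cast
    ring
  have h := congrArg norm key
  rw [norm_mul, Complex.norm_real, Real.norm_eq_abs] at h
  rw [h]
  calc ‖(f x - f c) - dividedDiff f (c, y) * ((x - c : ℝ) : ℂ)‖
      ≤ ‖f x - f c‖ + ‖dividedDiff f (c, y) * ((x - c : ℝ) : ℂ)‖ := norm_sub_le _ _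
    _ ≤ L * |x - c| + L * |x - c| := by
        rw [norm_mul, Complex.norm_real, Real.norm_eq_abs]
        gcongr
        · exact hf x c
        · exact norm_dividedDiff_le hL hf c y
    _ = 2 * L * |x - c| := by ring

end DividedDifference

/-! ### Cells of a finite set of reals -/

section Cells

open Finset

/-- A finite set of weighted points of the line is cut into at most `4 * N + 1` consecutive cells,
each of which is a single point or carries a small weight. -/
lemma exists_monotone_index (X : Finset ℝ) (w : ℝ → ℝ) (hw : ∀ x, 0 ≤ w x)
    (hsum : ∑ x ∈ X, w x ≤ 2) (N : ℕ) (hN : 1 ≤ N) :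
    ∃ κ : ℝ → ℕ, Monotone κ ∧ (∀ x, κ x ≤ 4 * N) ∧
      ∀ k, (∀ x ∈ X, ∀ y ∈ X, κ x = k → κ y = k → x = y) ∨
        ∑ x ∈ X with κ x = k, w x ≤ 1 / N := by
  set F : ℝ → ℝ := fun x => ∑ z ∈ X with z ≤ x, w z with hF
  set G : ℝ → ℝ := fun x => ∑ z ∈ X with z < x, w z with hG
  have hN0 : (0 : ℝ) < N := by exact_mod_cast hN
  have hFmono : Monotone F := fun x y hxy =>
    sum_le_sum_of_subset_of_nonneg
      (fun z hz => by simp only [mem_filter] at hz ⊢; exact ⟨hz.1, hz.2.trans hxy⟩)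
      (fun z _ _ => hw z)
  have hGmono : Monotone G := fun x y hxy =>
    sum_le_sum_of_subset_of_nonneg
      (fun z hz => by simp only [mem_filter] at hz ⊢; exact ⟨hz.1, hz.2.trans_le hxy⟩)
      (fun z _ _ => hw z)
  have hFG : ∀ {x y}, x < y → F x ≤ G y := fun {x y} hxy =>
    sum_le_sum_of_subset_of_nonneg
      (fun z hz => by simp only [mem_filter] at hz ⊢; exact ⟨hz.1, hz.2.trans_lt hxy⟩)
      (fun z _ _ => hw z)
  have hF2 : ∀ x, F x ≤ 2 := fun x =>
    (sum_le_sum_of_subset_of_nonneg (filter_subset _ _) (fun z _ _ => hw z)).trans hsum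
  have hG2 : ∀ x, G x ≤ 2 := fun x =>
    (sum_le_sum_of_subset_of_nonneg (filter_subset _ _) (fun z _ _ => hw z)).trans hsum
  have hG0 : ∀ x, 0 ≤ G x := fun x => sum_nonneg fun z _ => hw z
  have hfloor : ∀ r : ℝ, r ≤ 2 → ⌊N * r⌋₊ ≤ 2 * N := fun r hr => by
    refine Nat.floor_le_of_le ?_
    push_cast
    nlinarith
  have m1 : Monotone fun x => ⌊N * F x⌋₊ := fun x y hxy =>
    Nat.floor_mono (mul_le_mul_of_nonneg_left (hFmono hxy) hN0.le)
  have m2 : Monotone fun x => ⌊N * G x⌋₊ := fun x y hxy =>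
    Nat.floor_mono (mul_le_mul_of_nonneg_left (hGmono hxy) hN0.le)
  -- `F` counts the weight at `x` itself and `G` does not. With `F` alone, a heavy point could share
  -- its cell with light points to its right; `G` separates them. Each floor is at most `2 * N`.
  refine ⟨fun x => ⌊N * F x⌋₊ + ⌊N * G x⌋₊, m1.add m2, fun x => ?_, fun k => ?_⟩
  · have := hfloor _ (hF2 x)
    have := hfloor _ (hG2 x)
    dsimp only
    omega
  by_cases hk : ∀ x ∈ X, ∀ y ∈ X, ⌊N * F x⌋₊ + ⌊N * G x⌋₊ = k →
      ⌊N * F y⌋₊ + ⌊N * G y⌋₊ = k → x = y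
  · exact Or.inl hk
  right
  push Not at hk
  obtain ⟨x, hx, y, hy, hxk, hyk, hxy⟩ := hk
  set S := X.filter fun x => ⌊N * F x⌋₊ + ⌊N * G x⌋₊ = k with hS
  have hxS : x ∈ S := mem_filter.2 ⟨hx, hxk⟩
  have hyS : y ∈ S := mem_filter.2 ⟨hy, hyk⟩
  have hne : S.Nonempty := ⟨x, hxS⟩
  set l := S.min' hne with hl
  set u := S.max' hne with hu
  have hlu : l < u := S.min'_lt_max' hxS hyS hxy
  have hlk := (mem_filter.1 (S.min'_mem hne)).2
  have huk := (mem_filter.1 (S.max'_mem hne)).2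
  rw [← hl] at hlk
  rw [← hu] at huk
  have e1 := m1 hlu.le
  have e2 := m2 hlu.le
  dsimp only at e1 e2
  have e3 : ⌊N * F l⌋₊ ≤ ⌊N * G u⌋₊ :=
    Nat.floor_mono (mul_le_mul_of_nonneg_left (hFG hlu) hN0.le)
  -- Equal sums of two monotone floors force equality of each floor. Hence `N * (F u - G l) < 1`,
  -- and `F u - G l` dominates the weight of the cell.
  have e4 : ⌊N * F u⌋₊ ≤ ⌊N * G l⌋₊ := by omega
  have e5 : N * F u < ⌊N * F u⌋₊ + 1 := Nat.lt_floor_add_one _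
  have e6 : (⌊N * G l⌋₊ : ℝ) ≤ N * G l := Nat.floor_le (mul_nonneg hN0.le (hG0 l))
  have e7 : (⌊N * F u⌋₊ : ℝ) ≤ ⌊N * G l⌋₊ := by exact_mod_cast e4
  have e8 : ∑ z ∈ S, w z + G l ≤ F u := by
    rw [hG, hF]
    dsimp only
    rw [← sum_union]
    · refine sum_le_sum_of_subset_of_nonneg (fun z hz => ?_) (fun z _ _ => hw z)
      rcases mem_union.1 hz with hz | hz
      · exact mem_filter.2 ⟨(mem_filter.1 hz).1, S.le_max' z hz⟩
      · exact mem_filter.2 ⟨(mem_filter.1 hz).1, ((mem_filter.1 hz).2.trans hlu).le⟩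
    · rw [disjoint_left]
      intro z hz hz'
      exact absurd (S.min'_le z hz) (not_le.2 (mem_filter.1 hz').2)
  rw [le_div_iff₀ hN0]
  nlinarith

/-- The end points belong to the cell and to `X`, so a cell of positive length has two distinct
points and must be one of small weight. -/
lemma exists_cell_endpoints (X : Finset ℝ) (κ : ℝ → ℕ) :
    ∃ lo hi : ℕ → ℝ, ∀ x ∈ X, lo (κ x) ≤ x ∧ x ≤ hi (κ x) ∧
      lo (κ x) ∈ X ∧ κ (lo (κ x)) = κ x ∧ hi (κ x) ∈ X ∧ κ (hi (κ x)) = κ x := by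
  have : ∀ k, ∃ l h : ℝ, ∀ x ∈ X, κ x = k → l ≤ x ∧ x ≤ h ∧ l ∈ X ∧ κ l = k ∧ h ∈ X ∧ κ h = k := by
    intro k
    by_cases hne : (X.filter fun x => κ x = k).Nonempty
    · refine ⟨(X.filter fun x => κ x = k).min' hne, (X.filter fun x => κ x = k).max' hne,
        fun x hx hxk => ?_⟩
      have hmem : x ∈ X.filter fun x => κ x = k := mem_filter.2 ⟨hx, hxk⟩
      have h1 := mem_filter.1 ((X.filter fun x => κ x = k).min'_mem hne)
      have h2 := mem_filter.1 ((X.filter fun x => κ x = k).max'_mem hne)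
      exact ⟨min'_le _ _ hmem, le_max' _ _ hmem, h1.1, h1.2, h2.1, h2.2⟩
    · exact ⟨0, 0, fun x hx hxk => absurd ⟨x, mem_filter.2 ⟨hx, hxk⟩⟩ hne⟩
  choose lo hi h using this
  exact ⟨lo, hi, fun x hx => h (κ x) x hx rfl⟩

lemma sum_inv_sq_le_two (n : ℕ) : ∑ s ∈ range n, 1 / ((s : ℝ) + 1) ^ 2 ≤ 2 := by
  have : ∀ n : ℕ, ∑ s ∈ range (n + 1), 1 / ((s : ℝ) + 1) ^ 2 ≤ (2 : ℝ) - 1 / ((n : ℝ) + 1) := by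
    intro n
    induction n with
    | zero => norm_num
    | succ n ih =>
      rw [sum_range_succ]
      have h0 : (0 : ℝ) ≤ n := n.cast_nonneg
      have : 1 / (((n + 1 : ℕ) : ℝ) + 1) ^ 2 ≤ 1 / ((n : ℝ) + 1) - 1 / (((n + 1 : ℕ) : ℝ) + 1) := by
        push_cast
        rw [div_sub_div _ _ (by positivity) (by positivity), div_le_div_iff₀ (by positivity)
          (by positivity)]
        nlinarith
      linarith
  cases n with
  | zero => simp
  | succ n => exact (this n).trans (sub_le_self _ (by positivity))

/-- If the points `t i` are `ℓ`-separated, then `∑ min 1 (ℓ / t i) ^ 2` is bounded. -/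
lemma sum_sq_le_of_separated {ι : Type*} (K : Finset ι) (t d : ι → ℝ) {ℓ : ℝ} (hℓ : 0 < ℓ)
    (ht : ∀ i ∈ K, 0 ≤ t i) (hd0 : ∀ i ∈ K, 0 ≤ d i) (hd1 : ∀ i ∈ K, d i ≤ 1)
    (hdt : ∀ i ∈ K, d i * t i ≤ ℓ)
    (hsep : ∀ i ∈ K, ∀ j ∈ K, i ≠ j → ℓ ≤ |t i - t j|) :
    ∑ i ∈ K, d i ^ 2 ≤ 8 := by
  classical
  set s : ι → ℕ := fun i => ⌊t i / ℓ⌋₊ with hs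
  have hinj : Set.InjOn s K := by
    intro i hi j hj hij
    by_contra hne
    have h := hsep i hi j hj hne
    have h1 := Nat.floor_le (div_nonneg (ht i hi) hℓ.le)
    have h2 := Nat.lt_floor_add_one (t i / ℓ)
    have h3 := Nat.floor_le (div_nonneg (ht j hj) hℓ.le)
    have h4 := Nat.lt_floor_add_one (t j / ℓ)
    change ⌊t i / ℓ⌋₊ = ⌊t j / ℓ⌋₊ at hij
    rw [hij] at h1 h2
    rw [le_div_iff₀ hℓ] at h1 h3
    rw [div_lt_iff₀ hℓ] at h2 h4
    rcases le_abs'.1 h with h | h <;> linarith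
  -- From `d ≤ 1` and `d * s ≤ 1` one gets `d * (s + 1) ≤ 2`; as `s` is injective on `K`, the total
  -- is at most `4 * 2`.
  have hbound : ∀ i ∈ K, d i ^ 2 ≤ 4 * (1 / ((s i : ℝ) + 1) ^ 2) := by
    intro i hi
    have h1 := Nat.floor_le (div_nonneg (ht i hi) hℓ.le)
    change (s i : ℝ) ≤ _ at h1
    have h2 : d i * (t i / ℓ) ≤ 1 := by
      rw [← mul_div_assoc, div_le_one hℓ]
      exact hdt i hi
    have h3 : d i * (s i + 1) ≤ 2 := by
      have := mul_le_mul_of_nonneg_left h1 (hd0 i hi)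
      have := hd1 i hi
      linarith
    have h4 : 0 ≤ d i * (s i + 1) := mul_nonneg (hd0 i hi) (by positivity)
    rw [mul_one_div, le_div_iff₀ (by positivity), ← mul_pow]
    nlinarith
  obtain ⟨n, hn⟩ : ∃ n, K.image s ⊆ range n := by
    obtain ⟨n, hn⟩ := (K.image s).exists_nat_subset_range
    exact ⟨n, hn⟩
  calc ∑ i ∈ K, d i ^ 2 ≤ ∑ i ∈ K, 4 * (1 / ((s i : ℝ) + 1) ^ 2) := sum_le_sum hbound
    _ = 4 * ∑ m ∈ K.image s, 1 / ((m : ℝ) + 1) ^ 2 := by rw [sum_image hinj, mul_sum]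
    _ ≤ 4 * ∑ m ∈ range n, 1 / ((m : ℝ) + 1) ^ 2 := by
        gcongr
    _ ≤ 8 := by linarith [sum_inv_sq_le_two n]

end Cells

/-! ### Approximation of the divided difference by kernels of small rank -/

section KernelApproximation

open Finset

variable {f : ℝ → ℂ} {L : ℝ}

/-- The row estimate: replacing `x` by the left end point of its cell, in the part of the kernel
where the cell of `y` is at least as long as the cell of `x`. -/
lemma sum_row_le (hL : 0 ≤ L) (hf : ∀ x y, ‖f x - f y‖ ≤ L * |x - y|) (X : Finset ℝ)
    (κ : ℝ → ℕ) (hκ : Monotone κ) (lo hi : ℕ → ℝ)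
    (hlh : ∀ x ∈ X, lo (κ x) ≤ x ∧ x ≤ hi (κ x) ∧
      lo (κ x) ∈ X ∧ κ (lo (κ x)) = κ x ∧ hi (κ x) ∈ X ∧ κ (hi (κ x)) = κ x)
    (q : ℝ → ℝ) (hq : ∀ x, 0 ≤ q x) {δ : ℝ} (hδ : 0 ≤ δ)
    (hcell : ∀ k, (∀ x ∈ X, ∀ y ∈ X, κ x = k → κ y = k → x = y) ∨
      ∑ x ∈ X with κ x = k, q x ≤ δ)
    {x : ℝ} (hx : x ∈ X) :
    ∑ y ∈ X with hi (κ x) - lo (κ x) ≤ hi (κ y) - lo (κ y),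
      q y * ‖dividedDiff f (x, y) -
        (if κ x = κ y then 0 else dividedDiff f (lo (κ x), y))‖ ^ 2 ≤ 65 * L ^ 2 * δ := by
  set ℓ := hi (κ x) - lo (κ x) with hℓ
  obtain ⟨hx1, hx2, hx3, hx4, hx5, hx6⟩ := hlh x hx
  have hℓ0 : 0 ≤ ℓ := by linarith
  rcases hℓ0.eq_or_lt with h0 | hpos
  -- A cell of length zero causes no error: freezing changes nothing, and the dropped diagonal block
  -- is one diagonal point, where the kernel vanishes.
  · refine (sum_eq_zero fun y hy => ?_).trans_le (by positivity)
    obtain ⟨hy1, hy2, -⟩ := hlh y (mem_filter.1 hy).1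
    have hxl : lo (κ x) = x := by linarith
    split_ifs with hxy
    · rw [← hxy] at hy1 hy2
      have : y = x := by linarith
      rw [this, dividedDiff_self]
      simp
    · rw [hxl]
      simp
  set Y := X.filter fun y => ℓ ≤ hi (κ y) - lo (κ y) with hY
  set e : ℝ → ℝ := fun y => ‖dividedDiff f (x, y) -
        (if κ x = κ y then 0 else dividedDiff f (lo (κ x), y))‖ with he
  set dR : ℕ → ℝ := fun k => if lo k - x ≤ ℓ then 1 else ℓ / (lo k - x) with hdR
  set dL : ℕ → ℝ := fun k => if x - hi k ≤ ℓ then 1 else ℓ / (x - hi k) with hdL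
  -- This bound for the squared error depends only on the cell of `y`. Its three parts sum to at
  -- most `L ^ 2`, `4 * 8 * L ^ 2` and `4 * 8 * L ^ 2`, whence 65.
  set c : ℕ → ℝ := fun k => (if k = κ x then L ^ 2 else 0) +
    (if κ x < k then 4 * L ^ 2 * dR k ^ 2 else 0) +
    (if k < κ x then 4 * L ^ 2 * dL k ^ 2 else 0) with hc
  have hfar : ∀ y, κ x ≠ κ y → e y ≤ 2 * L := fun y hxy => by
    simp only [he, hxy, if_false]
    exact norm_dividedDiff_sub_le_two_mul hL hf _ _ _
  have hfar' : ∀ y, κ x ≠ κ y → e y * |x - y| ≤ 2 * L * ℓ := fun y hxy => by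
    simp only [he, hxy, if_false]
    refine (norm_dividedDiff_sub_mul_le hL hf ?_).trans ?_
    · rintro rfl
      exact hxy hx4.symm
    · have : |x - lo (κ x)| ≤ ℓ := by
        rw [abs_of_nonneg (by linarith)]
        linarith
      gcongr
  have hlt : ∀ {y z : ℝ}, κ y < κ z → y < z := fun {y z} h => by
    by_contra hyz
    exact absurd (hκ (not_lt.1 hyz)) (not_le.2 h)
  have hec : ∀ y ∈ Y, e y ^ 2 ≤ c (κ y) := by
    intro y hy
    obtain ⟨hy1, hy2, hy3, hy4, hy5, hy6⟩ := hlh y (mem_filter.1 hy).1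
    have he0 : 0 ≤ e y := norm_nonneg _
    rcases lt_trichotomy (κ y) (κ x) with h | h | h
    · have h' : c (κ y) = (2 * L * dL (κ y)) ^ 2 := by
        simp only [hc, h, h.ne, h.not_gt, if_true, if_false]
        ring
      rw [h']
      refine pow_le_pow_left₀ he0 ?_ 2
      simp only [hdL]
      split_ifs with ht
      · simpa using hfar y h.ne'
      · rw [← mul_div_assoc, le_div_iff₀ (by linarith)]
        refine le_trans ?_ (hfar' y h.ne')
        rw [abs_of_pos (sub_pos.2 (hlt h))]
        gcongr
    · have h' : c (κ y) = L ^ 2 := by simp [hc, h]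
      rw [h']
      refine pow_le_pow_left₀ he0 ?_ 2
      simp only [he, h, if_true, sub_zero]
      exact norm_dividedDiff_le hL hf _ _
    · have h' : c (κ y) = (2 * L * dR (κ y)) ^ 2 := by
        simp only [hc, h, h.ne', h.not_gt, if_true, if_false]
        ring
      rw [h']
      refine pow_le_pow_left₀ he0 ?_ 2
      simp only [hdR]
      split_ifs with ht
      · simpa using hfar y h.ne
      · rw [← mul_div_assoc, le_div_iff₀ (by linarith)]
        refine le_trans ?_ (hfar' y h.ne)
        rw [abs_sub_comm, abs_of_pos (sub_pos.2 (hlt h))]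
        gcongr
  have hc0 : ∀ k, 0 ≤ c k := fun k => by
    simp only [hc]
    positivity
  set K := Y.image κ with hK
  have hKY : ∀ k ∈ K, ∃ y ∈ X, κ y = k ∧ ℓ ≤ hi k - lo k := by
    intro k hk
    obtain ⟨y, hy, rfl⟩ := mem_image.1 hk
    exact ⟨y, (mem_filter.1 hy).1, rfl, (mem_filter.1 hy).2⟩
  have hmass : ∀ k ∈ K, ∑ y ∈ Y with κ y = k, q y ≤ δ := by
    intro k hk
    obtain ⟨y, hy, rfl, hlen⟩ := hKY k hk
    obtain ⟨-, -, hy3, hy4, hy5, hy6⟩ := hlh y hy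
    rcases hcell (κ y) with h | h
    -- A single-point cell has length zero, contrary to `0 < ℓ`.
    · have := h _ hy3 _ hy5 hy4 hy6
      linarith
    · refine le_trans (sum_le_sum_of_subset_of_nonneg ?_ fun z _ _ => hq z) h
      exact filter_subset_filter _ (filter_subset _ _)
  have hord : ∀ i ∈ K, ∀ j ∈ K, i < j → hi i < lo j := by
    intro i hi' j hj hij
    obtain ⟨y, hy, rfl, -⟩ := hKY i hi'
    obtain ⟨z, hz, rfl, -⟩ := hKY j hj
    obtain ⟨-, -, -, -, -, hy6⟩ := hlh y hy
    obtain ⟨-, -, -, hz4, -, -⟩ := hlh z hz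
    exact hlt (by rw [hy6, hz4]; exact hij)
  have hR : ∑ k ∈ K with κ x < k, dR k ^ 2 ≤ 8 := by
    have hge : ∀ k ∈ K.filter fun k => κ x < k, 0 ≤ lo k - x := by
      intro k hk
      obtain ⟨hk, hxk⟩ := mem_filter.1 hk
      obtain ⟨y, hy, rfl, -⟩ := hKY k hk
      obtain ⟨-, -, -, hy4, -, -⟩ := hlh y hy
      exact (sub_pos.2 (hlt (by rw [hy4]; exact hxk))).le
    refine sum_sq_le_of_separated _ (fun k => lo k - x) dR hpos hge ?_ ?_ ?_ ?_
    · intro k hk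
      have := hge k hk
      simp only [hdR]
      positivity
    · intro k hk
      simp only [hdR]
      split_ifs with h
      · exact le_rfl
      · exact div_le_one_of_le₀ (not_le.1 h).le (hge k hk)
    · intro k hk
      simp only [hdR]
      split_ifs with h
      · simpa using h
      · rw [div_mul_cancel₀]
        exact (hpos.trans (not_le.1 h)).ne'
    · intro i hi' j hj hij
      obtain ⟨hiK, -⟩ := mem_filter.1 hi'
      obtain ⟨hjK, -⟩ := mem_filter.1 hj
      obtain ⟨-, -, -, hli⟩ := hKY i hiK
      obtain ⟨-, -, -, hlj⟩ := hKY j hjK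
      rw [le_abs']
      rcases lt_or_gt_of_ne hij with h | h
      · have := hord i hiK j hjK h
        left; linarith
      · have := hord j hjK i hiK h
        right; linarith
  have hLeft : ∑ k ∈ K with k < κ x, dL k ^ 2 ≤ 8 := by
    have hge : ∀ k ∈ K.filter fun k => k < κ x, 0 ≤ x - hi k := by
      intro k hk
      obtain ⟨hk, hxk⟩ := mem_filter.1 hk
      obtain ⟨y, hy, rfl, -⟩ := hKY k hk
      obtain ⟨-, -, -, -, -, hy6⟩ := hlh y hy
      exact (sub_pos.2 (hlt (by rw [hy6]; exact hxk))).le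
    refine sum_sq_le_of_separated _ (fun k => x - hi k) dL hpos hge ?_ ?_ ?_ ?_
    · intro k hk
      have := hge k hk
      simp only [hdL]
      positivity
    · intro k hk
      simp only [hdL]
      split_ifs with h
      · exact le_rfl
      · exact div_le_one_of_le₀ (not_le.1 h).le (hge k hk)
    · intro k hk
      simp only [hdL]
      split_ifs with h
      · simpa using h
      · rw [div_mul_cancel₀]
        exact (hpos.trans (not_le.1 h)).ne'
    · intro i hi' j hj hij
      obtain ⟨hiK, -⟩ := mem_filter.1 hi'
      obtain ⟨hjK, -⟩ := mem_filter.1 hj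
      obtain ⟨-, -, -, hli⟩ := hKY i hiK
      obtain ⟨-, -, -, hlj⟩ := hKY j hjK
      rw [le_abs']
      rcases lt_or_gt_of_ne hij with h | h
      · have := hord i hiK j hjK h
        right; linarith
      · have := hord j hjK i hiK h
        left; linarith
  have hcsum : ∑ k ∈ K, c k ≤ 65 * L ^ 2 := by
    simp only [hc]
    rw [sum_add_distrib, sum_add_distrib, ← sum_filter (fun k => κ x < k),
      ← sum_filter (fun k => k < κ x), ← mul_sum, ← mul_sum, sum_ite_eq']
    have h1 : (if κ x ∈ K then L ^ 2 else 0) ≤ L ^ 2 := by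
      split_ifs
      · exact le_rfl
      · positivity
    have h2 := mul_le_mul_of_nonneg_left hR (by positivity : 0 ≤ 4 * L ^ 2)
    have h3 := mul_le_mul_of_nonneg_left hLeft (by positivity : 0 ≤ 4 * L ^ 2)
    linarith
  calc ∑ y ∈ Y, q y * e y ^ 2
      ≤ ∑ y ∈ Y, q y * c (κ y) :=
        sum_le_sum fun y hy => mul_le_mul_of_nonneg_left (hec y hy) (hq y)
    _ = ∑ k ∈ K, ∑ y ∈ Y with κ y = k, q y * c (κ y) :=
        (sum_fiberwise_of_maps_to (fun y hy => mem_image_of_mem κ hy) _).symm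
    _ = ∑ k ∈ K, (∑ y ∈ Y with κ y = k, q y) * c k := by
        refine sum_congr rfl fun k _ => ?_
        rw [sum_mul]
        exact sum_congr rfl fun y hy => by rw [(mem_filter.1 hy).2]
    _ ≤ ∑ k ∈ K, δ * c k :=
        sum_le_sum fun k hk => mul_le_mul_of_nonneg_right (hmass k hk) (hc0 k)
    _ = δ * ∑ k ∈ K, c k := (mul_sum _ _ _).symm
    _ ≤ δ * (65 * L ^ 2) := mul_le_mul_of_nonneg_left hcsum hδ
    _ = 65 * L ^ 2 * δ := by ring

/-- The divided difference of a Lipschitz function is approximated, in the Hilbert-Schmidt norm of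
a finite product of weighted sets of total mass one, by kernels of rank at most `8 * N + 2`. -/
lemma exists_kernel_approx (hL : 0 ≤ L) (hf : ∀ x y, ‖f x - f y‖ ≤ L * |x - y|) (X : Finset ℝ)
    (p q : ℝ → ℝ) (hp : ∀ x, 0 ≤ p x) (hq : ∀ x, 0 ≤ q x) (hp1 : ∑ x ∈ X, p x ≤ 1)
    (hq1 : ∑ x ∈ X, q x ≤ 1) (N : ℕ) (hN : 1 ≤ N) :
    ∃ g α β : ℕ → ℝ → ℂ, ∑ x ∈ X, ∑ y ∈ X, p x * q y * ‖dividedDiff f (x, y) -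
      ∑ k ∈ range (4 * N + 1), (g k x * α k y + β k x * g k y)‖ ^ 2 ≤ 130 * L ^ 2 / N := by
  -- Cutting according to the joint weight `p + q` lets the same cells serve both variables.
  obtain ⟨κ, hκ, hκN, hcell⟩ := exists_monotone_index X (fun x => p x + q x)
    (fun x => add_nonneg (hp x) (hq x)) (by rw [sum_add_distrib]; linarith) N hN
  obtain ⟨lo, hi, hlh⟩ := exists_cell_endpoints X κ
  have hδ : (0 : ℝ) ≤ 1 / N := by positivity
  have hcp : ∀ k, (∀ x ∈ X, ∀ y ∈ X, κ x = k → κ y = k → x = y) ∨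
      ∑ x ∈ X with κ x = k, p x ≤ 1 / N := fun k => (hcell k).imp_right
    (le_trans (sum_le_sum fun x _ => le_add_of_nonneg_right (hq x)))
  have hcq : ∀ k, (∀ x ∈ X, ∀ y ∈ X, κ x = k → κ y = k → x = y) ∨
      ∑ x ∈ X with κ x = k, q x ≤ 1 / N := fun k => (hcell k).imp_right
    (le_trans (sum_le_sum fun x _ => le_add_of_nonneg_left (hp x)))
  set len : ℕ → ℝ := fun k => hi k - lo k with hlen
  set Ψ : ℝ → ℝ → ℂ := fun x y => if κ x = κ y then 0 else
    if len (κ x) ≤ len (κ y) then dividedDiff f (lo (κ x), y)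
      else dividedDiff f (x, lo (κ y)) with hΨ
  -- `g k` is the indicator of cell `k`; `α k` is used when `x` is frozen there and `β k` when `y`
  -- is.
  refine ⟨fun k x => if κ x = k then 1 else 0,
    fun k y => if k ≠ κ y ∧ len k ≤ len (κ y) then dividedDiff f (lo k, y) else 0,
    fun k x => if κ x ≠ k ∧ ¬ len (κ x) ≤ len k then dividedDiff f (x, lo k) else 0, ?_⟩
  have hsum : ∀ x y, ∑ k ∈ range (4 * N + 1), ((if κ x = k then (1 : ℂ) else 0) *
      (if k ≠ κ y ∧ len k ≤ len (κ y) then dividedDiff f (lo k, y) else 0) +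
      (if κ x ≠ k ∧ ¬ len (κ x) ≤ len k then dividedDiff f (x, lo k) else 0) *
      (if κ y = k then 1 else 0)) = Ψ x y := by
    intro x y
    have hx : κ x ∈ range (4 * N + 1) := mem_range.2 (Nat.lt_succ_of_le (hκN x))
    have hy : κ y ∈ range (4 * N + 1) := mem_range.2 (Nat.lt_succ_of_le (hκN y))
    rw [sum_add_distrib, sum_eq_single_of_mem _ hx fun k _ hk => by simp [hk.symm],
      sum_eq_single_of_mem _ hy fun k _ hk => by simp [hk.symm]]
    simp only [hΨ]
    by_cases h1 : κ x = κ y <;> by_cases h2 : len (κ x) ≤ len (κ y) <;> simp [h1, h2]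
  simp only [hsum]
  set E : ℝ → ℝ → ℝ := fun x y => p x * q y * ‖dividedDiff f (x, y) - Ψ x y‖ ^ 2 with hE
  have hrow : ∑ x ∈ X, ∑ y ∈ X with len (κ x) ≤ len (κ y), E x y ≤ 65 * L ^ 2 * (1 / N) := by
    calc ∑ x ∈ X, ∑ y ∈ X with len (κ x) ≤ len (κ y), E x y
        ≤ ∑ x ∈ X, p x * (65 * L ^ 2 * (1 / N)) := by
          refine sum_le_sum fun x hx => ?_
          refine le_trans (le_of_eq ?_) (mul_le_mul_of_nonneg_left
            (sum_row_le hL hf X κ hκ lo hi hlh q hq hδ hcq hx) (hp x))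
          rw [mul_sum]
          refine sum_congr rfl fun y hy => ?_
          have hxy : len (κ x) ≤ len (κ y) := (mem_filter.1 hy).2
          simp only [hE, hΨ, hxy, if_true]
          ring
      _ ≤ 65 * L ^ 2 * (1 / N) := by
          rw [← sum_mul]
          exact mul_le_of_le_one_left (by positivity) hp1
  -- By symmetry of the divided difference this is the row estimate with the variables exchanged.
  have hcol : ∑ y ∈ X, ∑ x ∈ X with ¬ len (κ x) ≤ len (κ y), E x y ≤ 65 * L ^ 2 * (1 / N) := by
    calc ∑ y ∈ X, ∑ x ∈ X with ¬ len (κ x) ≤ len (κ y), E x y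
        ≤ ∑ y ∈ X, q y * (65 * L ^ 2 * (1 / N)) := by
          refine sum_le_sum fun y hy => ?_
          refine le_trans ?_ (mul_le_mul_of_nonneg_left
            (sum_row_le hL hf X κ hκ lo hi hlh p hp hδ hcp hy) (hq y))
          rw [mul_sum]
          refine le_trans (le_of_eq (sum_congr rfl fun x hx => ?_))
            (sum_le_sum_of_subset_of_nonneg (fun x hx => mem_filter.2
              ⟨(mem_filter.1 hx).1, (not_le.1 (mem_filter.1 hx).2).le⟩)
              fun x _ _ => mul_nonneg (hq y) (mul_nonneg (hp x) (sq_nonneg _)))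
          simp only [hE, hΨ, (mem_filter.1 hx).2, if_false, dividedDiff_comm f x,
            eq_comm (a := κ x)]
          ring
      _ ≤ 65 * L ^ 2 * (1 / N) := by
          rw [← sum_mul]
          exact mul_le_of_le_one_left (by positivity) hq1
  have hsplit : ∑ x ∈ X, ∑ y ∈ X, E x y =
      ∑ x ∈ X, ∑ y ∈ X with len (κ x) ≤ len (κ y), E x y +
      ∑ y ∈ X, ∑ x ∈ X with ¬ len (κ x) ≤ len (κ y), E x y := by
    have : ∑ y ∈ X, ∑ x ∈ X with ¬ len (κ x) ≤ len (κ y), E x y =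
        ∑ x ∈ X, ∑ y ∈ X with ¬ len (κ x) ≤ len (κ y), E x y := by
      simp only [sum_filter]
      exact sum_comm
    rw [this, ← sum_add_distrib]
    exact sum_congr rfl fun x _ => (sum_filter_add_sum_filter_not _ _ _).symm
  rw [hsplit]
  have : 130 * L ^ 2 / N = 65 * L ^ 2 * (1 / N) + 65 * L ^ 2 * (1 / N) := by ring
  linarith

end KernelApproximation

/-! ### Sums of matrix elements along orthonormal families -/

section MatrixElements

open Finset InnerProductSpace

variable {H₁ H₂ : Type*} [NormedAddCommGroup H₁] [InnerProductSpace ℂ H₁]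
  [NormedAddCommGroup H₂] [InnerProductSpace ℂ H₂] {ι : Type*} [Fintype ι]

lemma norm_sum_sq_of_pairwise_inner_eq_zero {α : Type*} (X : Finset α) (a : α → H₁)
    (h : ∀ x ∈ X, ∀ y ∈ X, x ≠ y → inner ℂ (a x) (a y) = 0) :
    ‖∑ x ∈ X, a x‖ ^ 2 = ∑ x ∈ X, ‖a x‖ ^ 2 := by
  classical
  induction X using Finset.induction_on with
  | empty => simp
  | insert z X hz ih =>
    have h0 : inner ℂ (a z) (∑ x ∈ X, a x) = 0 := by
      rw [inner_sum]
      refine sum_eq_zero fun x hx => h z (mem_insert_self _ _) x (mem_insert_of_mem hx) ?_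
      rintro rfl
      exact hz hx
    rw [sum_insert hz, sum_insert hz, ← ih fun x hx y hy =>
      h x (mem_insert_of_mem hx) y (mem_insert_of_mem hy)]
    have := norm_add_sq_eq_norm_sq_add_norm_sq_of_inner_eq_zero (𝕜 := ℂ) _ _ h0
    simpa only [sq] using this

/-- This handles the remainder left by the last approximant, whose rank is not under control. -/
lemma sum_norm_inner_le_sqrt_card {e : ι → H₁} {f : ι → H₂} (he : ∀ i, ‖e i‖ = 1)
    (K : H₂ →L[ℂ] H₁) :
    ∑ i, ‖inner ℂ (e i) (K (f i))‖ ≤ √(Fintype.card ι) * √(∑ i, ‖K (f i)‖ ^ 2) := by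
  calc ∑ i, ‖inner ℂ (e i) (K (f i))‖ ≤ ∑ i, 1 * ‖K (f i)‖ := by
        refine sum_le_sum fun i _ => ?_
        rw [← he i]
        exact norm_inner_le_norm _ _
    _ ≤ √(∑ _i : ι, 1 ^ 2) * √(∑ i, ‖K (f i)‖ ^ 2) := Real.sum_mul_le_sqrt_mul_sqrt _ _ _
    _ = _ := by simp

/-- Only the projections of the `e i` onto the range matter, and by Bessel's inequality for a basis
of the range their squared norms sum to at most the rank. The bound is thus free of the number of
vectors. -/
lemma sum_norm_inner_le_sqrt_rank {e : ι → H₁} {f : ι → H₂} (he : Orthonormal ℂ e)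
    (K : H₂ →L[ℂ] H₁) {r : ℕ} (hK : (K : H₂ →ₗ[ℂ] H₁).rank ≤ r) :
    ∑ i, ‖inner ℂ (e i) (K (f i))‖ ≤ √r * √(∑ i, ‖K (f i)‖ ^ 2) := by
  set V : Submodule ℂ H₁ := LinearMap.range (K : H₂ →ₗ[ℂ] H₁) with hV
  have hVr : Module.rank ℂ V ≤ r := hK
  have hfin : FiniteDimensional ℂ V :=
    Module.rank_lt_aleph0_iff.1 (hVr.trans_lt Cardinal.natCast_lt_aleph0)
  have hfr : Module.finrank ℂ V ≤ r := Module.finrank_le_of_rank_le hVr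
  let w := stdOrthonormalBasis ℂ V
  have hproj : ∀ i, inner ℂ (e i) (K (f i)) = inner ℂ (V.starProjection (e i)) (K (f i)) := by
    intro i
    have hKf : K (f i) ∈ V := LinearMap.mem_range_self (K : H₂ →ₗ[ℂ] H₁) (f i)
    rw [Submodule.inner_starProjection_left_eq_right, Submodule.starProjection_eq_self_iff.2 hKf]
  have hnorm : ∑ i, ‖V.starProjection (e i)‖ ^ 2 ≤ r := by
    have h1 : ∀ i, ‖V.starProjection (e i)‖ ^ 2 = ∑ l, ‖inner ℂ (e i) (w l : H₁)‖ ^ 2 := by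
      intro i
      rw [Submodule.starProjection_apply, ← Submodule.coe_norm, ← w.sum_sq_norm_inner_right]
      refine sum_congr rfl fun l _ => ?_
      rw [Submodule.coe_inner, ← Submodule.starProjection_apply,
        ← Submodule.inner_starProjection_left_eq_right,
        Submodule.starProjection_eq_self_iff.2 (w l).2, norm_inner_symm]
    calc ∑ i, ‖V.starProjection (e i)‖ ^ 2
        = ∑ l, ∑ i, ‖inner ℂ (e i) (w l : H₁)‖ ^ 2 := by
          rw [sum_comm]
          exact sum_congr rfl fun i _ => h1 i
      _ ≤ ∑ l, ‖(w l : H₁)‖ ^ 2 := sum_le_sum fun l _ => he.sum_inner_products_le _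
      _ = Module.finrank ℂ V := by
          have : ∀ l, ‖(w l : H₁)‖ = 1 := fun l => w.orthonormal.1 l
          simp [this]
      _ ≤ r := by exact_mod_cast hfr
  calc ∑ i, ‖inner ℂ (e i) (K (f i))‖
      ≤ ∑ i, ‖V.starProjection (e i)‖ * ‖K (f i)‖ := by
        refine sum_le_sum fun i _ => ?_
        rw [hproj]
        exact norm_inner_le_norm _ _
    _ ≤ √(∑ i, ‖V.starProjection (e i)‖ ^ 2) * √(∑ i, ‖K (f i)‖ ^ 2) :=
        Real.sum_mul_le_sqrt_mul_sqrt _ _ _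
    _ ≤ √r * √(∑ i, ‖K (f i)‖ ^ 2) := by gcongr

lemma sum_norm_inner_add_le (e : ι → H₁) (f : ι → H₂) (K K' : H₂ →L[ℂ] H₁) :
    ∑ i, ‖inner ℂ (e i) ((K + K') (f i))‖ ≤
      ∑ i, ‖inner ℂ (e i) (K (f i))‖ + ∑ i, ‖inner ℂ (e i) (K' (f i))‖ := by
  rw [← sum_add_distrib]
  refine sum_le_sum fun i _ => ?_
  rw [_root_.add_apply, inner_add_right]
  exact norm_add_le _ _

lemma sum_norm_sq_sub_le (f : ι → H₂) (K K' : H₂ →L[ℂ] H₁) :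
    ∑ i, ‖(K - K') (f i)‖ ^ 2 ≤ 2 * ∑ i, ‖K (f i)‖ ^ 2 + 2 * ∑ i, ‖K' (f i)‖ ^ 2 := by
  rw [mul_sum, mul_sum, ← sum_add_distrib]
  refine sum_le_sum fun i _ => ?_
  have h := norm_sub_le (K (f i)) (K' (f i))
  have h0 := norm_nonneg (K (f i) - K' (f i))
  rw [_root_.sub_apply]
  nlinarith [sq_nonneg (‖K (f i)‖ - ‖K' (f i)‖)]

lemma rank_rankOne_le (a : H₁) (b : H₂) :
    (rankOne ℂ a b : H₂ →ₗ[ℂ] H₁).rank ≤ 1 := by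
  have : LinearMap.range (rankOne ℂ a b : H₂ →ₗ[ℂ] H₁) ≤ Submodule.span ℂ {a} := by
    rintro _ ⟨z, rfl⟩
    exact Submodule.smul_mem _ _ (Submodule.mem_span_singleton_self a)
  refine (Submodule.rank_mono this).trans ((rank_span_le _).trans ?_)
  simp

lemma rank_sub_le (K K' : H₂ →L[ℂ] H₁) :
    ((K - K' : H₂ →L[ℂ] H₁) : H₂ →ₗ[ℂ] H₁).rank ≤
      (K : H₂ →ₗ[ℂ] H₁).rank + (K' : H₂ →ₗ[ℂ] H₁).rank := by
  have h : (-K' : H₂ →ₗ[ℂ] H₁).rank = (K' : H₂ →ₗ[ℂ] H₁).rank := by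
    rw [LinearMap.rank, LinearMap.rank, LinearMap.range_neg]
  rw [ContinuousLinearMap.toLinearMap_sub, sub_eq_add_neg, ← h]
  exact LinearMap.rank_add_le _ _

/-- An operator that is approximated at every dyadic scale in the Hilbert-Schmidt sense, as if its
singular values decreased like `A / (1 + j)`, has logarithmically growing matrix sums. -/
lemma sum_norm_inner_le_log {e : ι → H₁} {f : ι → H₂} (he : Orthonormal ℂ e)
    (D : H₂ →L[ℂ] H₁) (R : ℕ → H₂ →L[ℂ] H₁) {A : ℝ} (hA : 0 ≤ A)
    (hD : ∑ i, ‖D (f i)‖ ^ 2 ≤ A ^ 2)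
    (hrank : ∀ t, (R t : H₂ →ₗ[ℂ] H₁).rank ≤ (10 * 2 ^ t : ℕ))
    (happrox : ∀ t, ∑ i, ‖(D - R t) (f i)‖ ^ 2 ≤ 130 * A ^ 2 / 2 ^ t) :
    ∑ i, ‖inner ℂ (e i) (D (f i))‖ ≤ 300 * A * Real.log (1 + Fintype.card ι) := by
  rcases isEmpty_or_nonempty ι with hι | hι
  · simp
  set S : (H₂ →L[ℂ] H₁) → ℝ := fun K => ∑ i, ‖inner ℂ (e i) (K (f i))‖ with hS
  set m := Fintype.card ι with hm
  have hm0 : m ≠ 0 := Fintype.card_ne_zero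
  have hsqrt : ∀ {u v c : ℝ}, 0 ≤ c → 0 ≤ u → u * v ≤ (c * A) ^ 2 → √u * √v ≤ c * A :=
    fun {u v c} hc hu h => by
      rw [← Real.sqrt_mul hu]
      exact (Real.sqrt_le_sqrt h).trans_eq (Real.sqrt_sq (by positivity))
  -- Rank 10 and squared Hilbert-Schmidt sum `262 * A ^ 2`, with `2620 ≤ 52 ^ 2`.
  have h0 : S (R 0) ≤ 52 * A := by
    refine (sum_norm_inner_le_sqrt_rank he (R 0) (hrank 0)).trans
      (hsqrt (by norm_num) (by positivity) ?_)
    have h1 := sum_norm_sq_sub_le f D (D - R 0)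
    have h2 := happrox 0
    rw [sub_sub_cancel] at h1
    have h3 : ∑ i, ‖R 0 (f i)‖ ^ 2 ≤ 262 * A ^ 2 := by
      rw [pow_zero, div_one] at h2
      linarith
    push_cast
    nlinarith [sq_nonneg A]
  -- The rank `30 * 2 ^ t` cancels against the squared sum `390 * A ^ 2 / 2 ^ t`, so every scale
  -- costs the same; `11700 ≤ 110 ^ 2`.
  have hstep : ∀ t, S (R (t + 1) - R t) ≤ 110 * A := by
    intro t
    have hr : ((R (t + 1) - R t : H₂ →L[ℂ] H₁) : H₂ →ₗ[ℂ] H₁).rank ≤ (30 * 2 ^ t : ℕ) := by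
      refine (rank_sub_le _ _).trans ((add_le_add (hrank (t + 1)) (hrank t)).trans ?_)
      rw [← Nat.cast_add]
      refine Nat.cast_le.2 ?_
      rw [pow_succ]
      omega
    refine (sum_norm_inner_le_sqrt_rank he _ hr).trans (hsqrt (by norm_num) (by positivity) ?_)
    have h1 := sum_norm_sq_sub_le f (D - R t) (D - R (t + 1))
    rw [sub_sub_sub_cancel_left] at h1
    have h2 := happrox t
    have h3 := happrox (t + 1)
    have hp : (0 : ℝ) < 2 ^ t := by positivity
    rw [le_div_iff₀ hp] at h2
    rw [le_div_iff₀ (by positivity), pow_succ] at h3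
    simp only [Nat.cast_mul, Nat.cast_pow, Nat.cast_ofNat]
    nlinarith [sq_nonneg A]
  have hR : ∀ t, S (R t) ≤ 52 * A + 110 * A * t := by
    intro t
    induction t with
    | zero => simpa using h0
    | succ t ih =>
      have h1 := sum_norm_inner_add_le e f (R (t + 1) - R t) (R t)
      rw [sub_add_cancel] at h1
      have h2 := hstep t
      simp only [hS] at h2 ih ⊢
      push_cast
      linarith
  -- At the scale `2 ^ M`, comparable to `m`, the crude bound by the number of vectors is already
  -- `O(A)`.
  set M := Nat.log 2 m with hM
  have hM1 : 2 ^ M ≤ m := Nat.pow_log_le_self 2 hm0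
  have hM2 : m < 2 ^ (M + 1) := Nat.lt_pow_succ_log_self (by norm_num) m
  have hlast : S (D - R M) ≤ 17 * A := by
    refine (sum_norm_inner_le_sqrt_card he.1 _).trans
      (hsqrt (by norm_num) (by positivity) ?_)
    have h2 := happrox M
    have h3 : (m : ℝ) ≤ 2 ^ M * 2 := by
      rw [← pow_succ]
      exact_mod_cast hM2.le
    have hp : (0 : ℝ) < 2 ^ M := by positivity
    calc (m : ℝ) * ∑ i, ‖(D - R M) (f i)‖ ^ 2
        ≤ (2 ^ M * 2) * (130 * A ^ 2 / 2 ^ M) := by gcongr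
      _ = 260 * A ^ 2 := by field_simp; ring
      _ ≤ (17 * A) ^ 2 := by nlinarith [sq_nonneg A]
  have htotal : S D ≤ 69 * A + 110 * A * M := by
    have h1 := sum_norm_inner_add_le e f (D - R M) (R M)
    rw [sub_add_cancel] at h1
    have h2 := hR M
    simp only [hS] at hlast h2 ⊢
    linarith
  have hlog2 : 0.69 < Real.log 2 := lt_trans (by norm_num) Real.log_two_gt_d9
  have hlogm : M * Real.log 2 ≤ Real.log (1 + m) := by
    rw [← Real.log_pow]
    refine Real.log_le_log (by positivity) ?_
    have : (2 : ℝ) ^ M ≤ m := by exact_mod_cast hM1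
    linarith
  have hlog1 : Real.log 2 ≤ Real.log (1 + m) := by
    refine Real.log_le_log (by norm_num) ?_
    have : (1 : ℝ) ≤ m := by exact_mod_cast Nat.one_le_iff_ne_zero.2 hm0
    linarith
  have hM0 : (0 : ℝ) ≤ M := M.cast_nonneg
  have : 69 + 110 * (M : ℝ) ≤ 300 * Real.log (1 + m) := by nlinarith
  calc S D ≤ A * (69 + 110 * M) := by linarith
    _ ≤ A * (300 * Real.log (1 + m)) := by gcongr
    _ = _ := by ring

end MatrixElements

/-! ### Finite kernel operators -/

section KernelOperator

open Finset InnerProductSpace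

variable {H₁ H₂ : Type*} [NormedAddCommGroup H₁] [InnerProductSpace ℂ H₁]
  [NormedAddCommGroup H₂] [InnerProductSpace ℂ H₂] {ι : Type*} [Fintype ι]

/-- The operator `∑ Ψ x y ⟪b y, ·⟫ a x`. -/
def kernelOp (X : Finset ℝ) (a : ℝ → H₁) (b : ℝ → H₂) (Ψ : ℝ → ℝ → ℂ) : H₂ →L[ℂ] H₁ :=
  ∑ x ∈ X, ∑ y ∈ X, Ψ x y • rankOne ℂ (a x) (b y)

variable (X : Finset ℝ) (a : ℝ → H₁) (b : ℝ → H₂)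

lemma kernelOp_apply (Ψ : ℝ → ℝ → ℂ) (u : H₂) :
    kernelOp X a b Ψ u = ∑ x ∈ X, (∑ y ∈ X, Ψ x y * inner ℂ (b y) u) • a x := by
  simp [kernelOp, sum_smul, mul_smul]

lemma kernelOp_sub (Ψ Ψ' : ℝ → ℝ → ℂ) :
    kernelOp X a b Ψ - kernelOp X a b Ψ' = kernelOp X a b fun x y => Ψ x y - Ψ' x y := by
  simp [kernelOp, sub_smul, sum_sub_distrib]

lemma rank_kernelOp_le (g α β : ℕ → ℝ → ℂ) (r : ℕ) :
    (kernelOp X a b (fun x y => ∑ k ∈ range r, (g k x * α k y + β k x * g k y)) :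
      H₂ →ₗ[ℂ] H₁).rank ≤ (2 * r : ℕ) := by
  have h : kernelOp X a b (fun x y => ∑ k ∈ range r, (g k x * α k y + β k x * g k y)) =
      ∑ k ∈ range r,
        (rankOne ℂ (∑ x ∈ X, g k x • a x) (∑ y ∈ X, (starRingEnd ℂ) (α k y) • b y) +
        rankOne ℂ (∑ x ∈ X, β k x • a x) (∑ y ∈ X, (starRingEnd ℂ) (g k y) • b y)) := by
    ext u
    simp only [kernelOp_apply, _root_.sum_apply, _root_.add_apply,
      rankOne_apply, sum_inner, inner_smul_left, RingHomCompTriple.comp_apply, RingHom.id_apply,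
      smul_sum, smul_smul]
    rw [← sum_congr rfl fun k _ => sum_add_distrib, sum_comm]
    refine sum_congr rfl fun x _ => ?_
    simp only [← add_smul, ← sum_smul]
    congr 1
    simp only [sum_mul]
    rw [sum_comm]
    refine sum_congr rfl fun k _ => ?_
    rw [← sum_add_distrib]
    refine sum_congr rfl fun y _ => ?_
    ring
  rw [h, ContinuousLinearMap.toLinearMap_sum]
  refine (LinearMap.rank_finsetSum_le _ _).trans ((sum_le_card_nsmul _ _ 2 fun k _ => ?_).trans ?_)
  · rw [ContinuousLinearMap.toLinearMap_add]
    refine (LinearMap.rank_add_le _ _).trans ?_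
    rw [← one_add_one_eq_two]
    exact add_le_add (rank_rankOne_le _ _) (rank_rankOne_le _ _)
  · simp [mul_comm]

variable {X a b}

/-- Pythagoras in `x`, Bessel along `f`, then Pythagoras in `y`: the right side is the squared norm
of the kernel in the weighted `ℓ²` space. -/
lemma sum_norm_sq_kernelOp_le (ha : ∀ x ∈ X, ∀ y ∈ X, x ≠ y → inner ℂ (a x) (a y) = 0)
    (hb : ∀ x ∈ X, ∀ y ∈ X, x ≠ y → inner ℂ (b x) (b y) = 0) (Ψ : ℝ → ℝ → ℂ)
    {f : ι → H₂} (hf : Orthonormal ℂ f) :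
    ∑ i, ‖kernelOp X a b Ψ (f i)‖ ^ 2 ≤
      ∑ x ∈ X, ∑ y ∈ X, ‖a x‖ ^ 2 * ‖b y‖ ^ 2 * ‖Ψ x y‖ ^ 2 := by
  have h1 : ∀ u, ‖kernelOp X a b Ψ u‖ ^ 2 = ∑ x ∈ X,
      ‖a x‖ ^ 2 * ‖inner ℂ u (∑ y ∈ X, (starRingEnd ℂ) (Ψ x y) • b y)‖ ^ 2 := by
    intro u
    rw [kernelOp_apply, norm_sum_sq_of_pairwise_inner_eq_zero]
    · refine sum_congr rfl fun x _ => ?_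
      rw [norm_smul, mul_pow, mul_comm, norm_inner_symm, sum_inner]
      simp only [inner_smul_left, RingHomCompTriple.comp_apply, RingHom.id_apply]
    · intro x hx y hy hxy
      rw [inner_smul_left, inner_smul_right, ha x hx y hy hxy]
      simp
  have h2 : ∀ x, ‖∑ y ∈ X, (starRingEnd ℂ) (Ψ x y) • b y‖ ^ 2 =
      ∑ y ∈ X, ‖b y‖ ^ 2 * ‖Ψ x y‖ ^ 2 := by
    intro x
    rw [norm_sum_sq_of_pairwise_inner_eq_zero]
    · refine sum_congr rfl fun y _ => ?_
      rw [norm_smul, mul_pow, mul_comm, RCLike.norm_conj]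
    · intro y hy z hz hyz
      rw [inner_smul_left, inner_smul_right, hb y hy z hz hyz]
      simp
  simp only [h1]
  rw [sum_comm]
  refine sum_le_sum fun x _ => ?_
  simp only [mul_assoc]
  rw [← mul_sum, ← mul_sum, ← h2]
  gcongr
  exact hf.sum_inner_products_le _

/-- The matrix sums of the divided difference kernel of a Lipschitz function grow at most
logarithmically. -/
theorem sum_norm_inner_kernelOp_dividedDiff_le {φ : ℝ → ℂ} {L : ℝ} (hL : 0 ≤ L)
    (hφ : ∀ x y, ‖φ x - φ y‖ ≤ L * |x - y|)
    (ha : ∀ x ∈ X, ∀ y ∈ X, x ≠ y → inner ℂ (a x) (a y) = 0)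
    (hb : ∀ x ∈ X, ∀ y ∈ X, x ≠ y → inner ℂ (b x) (b y) = 0)
    (ha1 : ∑ x ∈ X, ‖a x‖ ^ 2 ≤ 1) (hb1 : ∑ y ∈ X, ‖b y‖ ^ 2 ≤ 1)
    {e : ι → H₁} {f : ι → H₂} (he : Orthonormal ℂ e) (hf : Orthonormal ℂ f) :
    ∑ i, ‖inner ℂ (e i) (kernelOp X a b (fun x y => dividedDiff φ (x, y)) (f i))‖ ≤
      300 * L * Real.log (1 + Fintype.card ι) := by
  choose g α β h using fun t : ℕ => exists_kernel_approx hL hφ X (fun x => ‖a x‖ ^ 2)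
    (fun y => ‖b y‖ ^ 2) (fun _ => sq_nonneg _) (fun _ => sq_nonneg _) ha1 hb1 (2 ^ t)
    Nat.one_le_two_pow
  refine sum_norm_inner_le_log he _ (fun t => kernelOp X a b fun x y =>
    ∑ k ∈ range (4 * 2 ^ t + 1), (g t k x * α t k y + β t k x * g t k y)) hL ?_ ?_ ?_
  · refine (sum_norm_sq_kernelOp_le ha hb _ hf).trans ?_
    calc ∑ x ∈ X, ∑ y ∈ X, ‖a x‖ ^ 2 * ‖b y‖ ^ 2 * ‖dividedDiff φ (x, y)‖ ^ 2
        ≤ ∑ x ∈ X, ∑ y ∈ X, ‖a x‖ ^ 2 * ‖b y‖ ^ 2 * L ^ 2 := by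
          gcongr with x _ y _
          exact norm_dividedDiff_le hL hφ x y
      _ = (∑ x ∈ X, ‖a x‖ ^ 2) * (∑ y ∈ X, ‖b y‖ ^ 2) * L ^ 2 := by
          rw [sum_mul_sum, sum_mul]
          exact sum_congr rfl fun x _ => (sum_mul _ _ _).symm
      _ ≤ 1 * 1 * L ^ 2 := by gcongr
      _ = L ^ 2 := by ring
  · intro t
    refine (rank_kernelOp_le X a b _ _ _ _).trans (Nat.cast_le.2 ?_)
    have : 1 ≤ 2 ^ t := Nat.one_le_two_pow
    omega
  · intro t
    rw [kernelOp_sub]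
    refine (sum_norm_sq_kernelOp_le ha hb _ hf).trans ((h t).trans_eq ?_)
    push_cast
    rfl

end KernelOperator

/-! ### Singular values -/

section SingularValues

open Finset InnerProductSpace

variable {H₁ H₂ : Type*} [NormedAddCommGroup H₁] [InnerProductSpace ℂ H₁]
  [NormedAddCommGroup H₂] [InnerProductSpace ℂ H₂]

lemma bddBelow_singularValue_set (T : H₂ →L[ℂ] H₁) (j : ℕ) :
    BddBelow {r : ℝ | ∃ R : H₂ →L[ℂ] H₁, (R : H₂ →ₗ[ℂ] H₁).rank ≤ (j : Cardinal) ∧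
      r = ‖T - R‖} :=
  ⟨0, by rintro _ ⟨R, -, rfl⟩; exact norm_nonneg _⟩

lemma nonempty_singularValue_set (T : H₂ →L[ℂ] H₁) (j : ℕ) :
    {r : ℝ | ∃ R : H₂ →L[ℂ] H₁, (R : H₂ →ₗ[ℂ] H₁).rank ≤ (j : Cardinal) ∧
      r = ‖T - R‖}.Nonempty :=
  ⟨_, 0, by simp, rfl⟩

lemma singularValue_nonneg (T : H₂ →L[ℂ] H₁) (j : ℕ) : 0 ≤ singularValue T j :=
  le_csInf (nonempty_singularValue_set T j) (by rintro _ ⟨R, -, rfl⟩; exact norm_nonneg _)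

lemma singularValue_le (T R : H₂ →L[ℂ] H₁) {j : ℕ} (hR : (R : H₂ →ₗ[ℂ] H₁).rank ≤ j) :
    singularValue T j ≤ ‖T - R‖ :=
  csInf_le (bddBelow_singularValue_set T j) ⟨R, hR, rfl⟩

lemma singularValue_antitone (T : H₂ →L[ℂ] H₁) : Antitone (singularValue T) := fun i j hij =>
  csInf_le_csInf (bddBelow_singularValue_set T j) (nonempty_singularValue_set T i)
    (by rintro _ ⟨R, hR, rfl⟩; exact ⟨R, hR.trans (Nat.cast_le.2 hij), rfl⟩)

lemma exists_norm_sub_lt_of_singularValue_lt (T : H₂ →L[ℂ] H₁) {j : ℕ} {r : ℝ}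
    (h : singularValue T j < r) :
    ∃ R : H₂ →L[ℂ] H₁, (R : H₂ →ₗ[ℂ] H₁).rank ≤ j ∧ ‖T - R‖ < r := by
  obtain ⟨_, ⟨R, hR, rfl⟩, hlt⟩ := exists_lt_of_csInf_lt (nonempty_singularValue_set T j) h
  exact ⟨R, hR, hlt⟩

lemma norm_le_singularValue_zero (T : H₂ →L[ℂ] H₁) : ‖T‖ ≤ singularValue T 0 := by
  refine le_csInf (nonempty_singularValue_set T 0) ?_
  rintro _ ⟨R, hR, rfl⟩
  have h0 : (R : H₂ →ₗ[ℂ] H₁).rank = 0 := le_antisymm (by simpa using hR) zero_le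
  have : R = 0 := by
    rw [LinearMap.rank, Submodule.rank_eq_zero, LinearMap.range_eq_bot] at h0
    exact ContinuousLinearMap.coe_injective h0
  simp [this]

lemma traceNorm_nonneg (T : H₂ →L[ℂ] H₁) : 0 ≤ traceNorm T :=
  tsum_nonneg (singularValue_nonneg T)

lemma norm_le_traceNorm {T : H₂ →L[ℂ] H₁} (hT : IsTraceClass T) : ‖T‖ ≤ traceNorm T :=
  (norm_le_singularValue_zero T).trans (hT.le_tsum 0 fun j _ => singularValue_nonneg T j)

lemma rank_le_of_forall_mem_span (K : H₂ →L[ℂ] H₁) {m : ℕ} (g : Fin m → H₁)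
    (h : ∀ u, K u ∈ Submodule.span ℂ (Set.range g)) : (K : H₂ →ₗ[ℂ] H₁).rank ≤ m := by
  have hfin : FiniteDimensional ℂ (Submodule.span ℂ (Set.range g)) :=
    FiniteDimensional.span_of_finite ℂ (Set.finite_range g)
  have hle : LinearMap.range (K : H₂ →ₗ[ℂ] H₁) ≤ Submodule.span ℂ (Set.range g) := by
    rintro _ ⟨u, rfl⟩
    exact h u
  refine (Submodule.rank_mono hle).trans ?_
  rw [← Module.finrank_eq_rank]
  exact Nat.cast_le.2 ((finrank_range_le_card (R := ℂ) g).trans_eq (Fintype.card_fin m))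

/-- The sum of the first singular values is controlled by the matrix sums along orthonormal
families. -/
lemma exists_orthonormal_sum_singularValue_le (Q : H₂ →L[ℂ] H₁) (n : ℕ) :
    ∃ m ≤ n, ∃ (e : Fin m → H₁) (f : Fin m → H₂), Orthonormal ℂ e ∧ Orthonormal ℂ f ∧
      ∑ j ∈ range n, singularValue Q (2 * j) ≤ 2 * ∑ i, ‖inner ℂ (e i) (Q (f i))‖ := by
  induction n with
  | zero =>
    exact ⟨0, le_rfl, ![], ![], by simp [Orthonormal, Subsingleton.pairwise],
      by simp [Orthonormal, Subsingleton.pairwise], by simp⟩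
  | succ n ih =>
    obtain ⟨m, hmn, e, f, he, hf, hsum⟩ := ih
    rw [sum_range_succ]
    rcases (singularValue_nonneg Q (2 * n)).eq_or_lt with h0 | hpos
    · exact ⟨m, hmn.trans n.le_succ, e, f, he, hf, by rw [← h0, add_zero]; exact hsum⟩
    set V : Submodule ℂ H₂ := Submodule.span ℂ (Set.range f) with hV
    set W : Submodule ℂ H₁ := Submodule.span ℂ (Set.range e) with hW
    have hVfin : FiniteDimensional ℂ V := FiniteDimensional.span_of_finite ℂ (Set.finite_range f)
    have hWfin : FiniteDimensional ℂ W := FiniteDimensional.span_of_finite ℂ (Set.finite_range e)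
    -- Greedy choice: compressing `Q` to the complements of `V` and `W` subtracts an operator of
    -- rank at most `2 * n`, which is why the index is doubled. The norm left is at least `s_{2n}`;
    -- half of it is attained at a vector, and this supplies the next pair.
    set R₁ : H₂ →L[ℂ] H₁ := Q ∘L V.starProjection with hR₁
    set R₂ : H₂ →L[ℂ] H₁ := W.starProjection ∘L (Q - R₁) with hR₂
    have hrank₁ : (R₁ : H₂ →ₗ[ℂ] H₁).rank ≤ m := by
      refine rank_le_of_forall_mem_span R₁ (fun i => Q (f i)) fun u => ?_
      have hmap : Submodule.map (Q : H₂ →ₗ[ℂ] H₁) V =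
          Submodule.span ℂ (Set.range fun i => Q (f i)) := by
        rw [hV, Submodule.map_span, ← Set.range_comp]
        rfl
      exact hmap.le (Submodule.mem_map_of_mem (Submodule.starProjection_apply_mem V u))
    have hrank₂ : (R₂ : H₂ →ₗ[ℂ] H₁).rank ≤ m :=
      rank_le_of_forall_mem_span R₂ e fun u => Submodule.starProjection_apply_mem W _
    have hrank : ((R₁ + R₂ : H₂ →L[ℂ] H₁) : H₂ →ₗ[ℂ] H₁).rank ≤ (2 * n : ℕ) := by
      rw [ContinuousLinearMap.toLinearMap_add]
      refine (LinearMap.rank_add_le _ _).trans ((add_le_add hrank₁ hrank₂).trans ?_)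
      rw [← Nat.cast_add]
      exact Nat.cast_le.2 (by omega)
    have hlt : singularValue Q (2 * n) / 2 < ‖Q - (R₁ + R₂)‖ :=
      (half_lt_self hpos).trans_le (singularValue_le Q _ hrank)
    obtain ⟨x, hx1, hx⟩ := ContinuousLinearMap.exists_lt_apply_of_lt_opNorm _ hlt
    set y := x - V.starProjection x with hy
    set z := Q y - W.starProjection (Q y) with hz
    have hzx : (Q - (R₁ + R₂)) x = z := by
      simp only [hR₁, hR₂, hz, hy, _root_.sub_apply, _root_.add_apply,
        ContinuousLinearMap.comp_apply, map_sub]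
      abel
    rw [hzx] at hx
    have hyV : y ∈ Vᗮ := Submodule.sub_starProjection_mem_orthogonal x
    have hzW : z ∈ Wᗮ := Submodule.sub_starProjection_mem_orthogonal (Q y)
    have hz0 : 0 < ‖z‖ := (half_pos hpos).trans hx
    have hy0 : 0 < ‖y‖ := by
      rw [norm_pos_iff]
      intro h
      rw [hz, h] at hz0
      simp at hz0
    have hy1 : ‖y‖ ≤ 1 := by
      have h1 : y = Vᗮ.starProjection x := by
        rw [Submodule.starProjection_orthogonal']
        rfl
      rw [h1]
      exact ((Vᗮ.starProjection.le_of_opNorm_le Vᗮ.starProjection_norm_le x).trans_eq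
        (one_mul _)).trans hx1.le
    have hzz : inner ℂ z (Q y) = (‖z‖ : ℂ) ^ 2 := by
      have h1 : Q y = z + W.starProjection (Q y) := (sub_add_cancel _ _).symm
      rw [h1, inner_add_right, Submodule.inner_left_of_mem_orthogonal
        (Submodule.starProjection_apply_mem W _) hzW, add_zero]
      exact inner_self_eq_norm_sq_to_K z
    refine ⟨m + 1, Nat.succ_le_succ hmn, Matrix.vecCons (((‖z‖ : ℂ)⁻¹) • z) e,
      Matrix.vecCons (((‖y‖ : ℂ)⁻¹) • y) f, ?_, ?_, ?_⟩
    · refine orthonormal_vecCons_iff.2 ⟨?_, fun i => ?_, he⟩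
      · rw [norm_smul, norm_inv, Complex.norm_real, norm_norm, inv_mul_cancel₀ hz0.ne']
      · rw [inner_smul_left, Submodule.inner_left_of_mem_orthogonal
          (Submodule.subset_span (Set.mem_range_self i)) hzW, mul_zero]
    · refine orthonormal_vecCons_iff.2 ⟨?_, fun i => ?_, hf⟩
      · rw [norm_smul, norm_inv, Complex.norm_real, norm_norm, inv_mul_cancel₀ hy0.ne']
      · rw [inner_smul_left, Submodule.inner_left_of_mem_orthogonal
          (Submodule.subset_span (Set.mem_range_self i)) hyV, mul_zero]
    · rw [Fin.sum_univ_succ]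
      simp only [Matrix.cons_val_zero, Matrix.cons_val_succ]
      have hnew : ‖z‖ ≤ ‖inner ℂ (((‖z‖ : ℂ)⁻¹) • z) (Q (((‖y‖ : ℂ)⁻¹) • y))‖ := by
        rw [map_smul, inner_smul_left, inner_smul_right, hzz]
        simp only [norm_mul, norm_pow, norm_inv, Complex.norm_real, norm_norm, RCLike.norm_conj]
        rw [sq, mul_left_comm, inv_mul_cancel_left₀ hz0.ne', inv_mul_eq_div]
        exact le_div_self hz0.le hy0 hy1
      linarith

/-- One factor 2 comes from the almost maximising vectors, the other from passing from even indices
to all indices by monotonicity. -/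
lemma sum_singularValue_le_of_forall (Q : H₂ →L[ℂ] H₁) (n : ℕ) {B : ℝ}
    (hB : ∀ m ≤ n, ∀ (e : Fin m → H₁) (f : Fin m → H₂), Orthonormal ℂ e → Orthonormal ℂ f →
      ∑ i, ‖inner ℂ (e i) (Q (f i))‖ ≤ B) :
    ∑ j ∈ range n, singularValue Q j ≤ 4 * B := by
  have h : ∀ n, ∑ j ∈ range (2 * n), singularValue Q j ≤
      2 * ∑ j ∈ range n, singularValue Q (2 * j) := by
    intro n
    induction n with
    | zero => simp
    | succ n ih =>
      rw [Nat.mul_succ, sum_range_succ, sum_range_succ, sum_range_succ]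
      have := singularValue_antitone Q (2 * n).le_succ
      simp only [Nat.succ_eq_add_one] at this
      linarith
  obtain ⟨m, hm, e, f, he, hf, hs⟩ := exists_orthonormal_sum_singularValue_le Q n
  calc ∑ j ∈ range n, singularValue Q j ≤ ∑ j ∈ range (2 * n), singularValue Q j :=
        sum_le_sum_of_subset_of_nonneg (range_subset_range.2 (by omega))
          fun j _ _ => singularValue_nonneg Q j
    _ ≤ 2 * ∑ j ∈ range n, singularValue Q (2 * j) := h n
    _ ≤ 4 * B := by linarith [hB m hm e f he hf]

end SingularValues

/-! ### Trace class operators as sums of operators of rank one -/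

section TraceClass

open Finset InnerProductSpace

variable {H₁ H₂ : Type*} [NormedAddCommGroup H₁] [InnerProductSpace ℂ H₁]
  [NormedAddCommGroup H₂] [InnerProductSpace ℂ H₂]

/-- Cauchy condensation for the decreasing singular values. -/
lemma sum_condensed_singularValue_le {T : H₂ →L[ℂ] H₁} (hT : IsTraceClass T) (n : ℕ) :
    ∑ k ∈ range n, (2 : ℝ) ^ k * singularValue T (2 ^ k) ≤ 2 * traceNorm T := by
  have h1 := sum_condensed_le (f := singularValue T)
    (fun m n _ hmn => singularValue_antitone T hmn) n
  have h2 : singularValue T 1 + ∑ k ∈ Ico 2 (2 ^ n + 1), singularValue T k ≤ traceNorm T := by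
    rw [← sum_insert (by simp)]
    exact hT.sum_le_tsum _ fun j _ => singularValue_nonneg T j
  have h3 := singularValue_nonneg T 1
  simp only [nsmul_eq_mul, Nat.cast_pow, Nat.cast_ofNat] at h1
  rw [sum_range_succ] at h1
  have h4 : 0 ≤ (2 : ℝ) ^ n * singularValue T (2 ^ n) :=
    mul_nonneg (by positivity) (singularValue_nonneg T _)
  linarith

/-- Dyadic decomposition of a trace class operator. -/
lemma exists_hasSum_dyadic [CompleteSpace H₁] {T : H₂ →L[ℂ] H₁} (hT : IsTraceClass T) (hT0 : T ≠ 0) :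
    ∃ D : ℕ → H₂ →L[ℂ] H₁, (∀ k, (D k : H₂ →ₗ[ℂ] H₁).rank ≤ (2 ^ (k + 1) : ℕ)) ∧
      (∀ n, ∑ k ∈ range n, (2 : ℝ) ^ (k + 1) * ‖D k‖ ≤ 26 * traceNorm T) ∧ HasSum D T := by
  set τ := traceNorm T with hτ
  have hτ0 : 0 < τ := (norm_pos_iff.2 hT0).trans_le (norm_le_traceNorm hT)
  -- The infimum need not be attained; the slack `τ / 4 ^ k` stays summable after multiplication by
  -- `2 ^ k`.
  choose R hRr hRn using fun k : ℕ => exists_norm_sub_lt_of_singularValue_lt T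
    (lt_add_of_pos_right (singularValue T (2 ^ k)) (by positivity : 0 < τ / 4 ^ k))
  set σ : ℕ → ℝ := fun k => singularValue T (2 ^ k) + τ / 4 ^ k with hσ
  have hσ0 : ∀ k, 0 ≤ σ k := fun k => add_nonneg (singularValue_nonneg T _) (by positivity)
  have hσsum : ∀ n, ∑ k ∈ range n, (2 : ℝ) ^ k * σ k ≤ 4 * τ := by
    intro n
    have h1 : ∀ k, (2 : ℝ) ^ k * σ k = 2 ^ k * singularValue T (2 ^ k) + τ * (1 / 2) ^ k := by
      intro k
      simp only [hσ]
      have : (4 : ℝ) ^ k = 2 ^ k * 2 ^ k := by rw [← mul_pow]; norm_num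
      rw [this, one_div, inv_pow]
      field_simp
    simp only [h1]
    rw [sum_add_distrib, ← mul_sum]
    have h2 := sum_condensed_singularValue_le hT n
    have h3 : ∑ k ∈ range n, (1 / 2 : ℝ) ^ k ≤ 2 := by
      exact (summable_geometric_two.sum_le_tsum _ fun k _ => by positivity).trans_eq
        tsum_geometric_two
    nlinarith
  -- The shifted sequence starts at 0, so that its differences telescope to `T`. The two weighted
  -- sums, at most `4 * τ` and `9 * τ`, give `26 = 2 * (4 + 9)`.
  set R' : ℕ → H₂ →L[ℂ] H₁ := fun k => Nat.casesOn k 0 R with hR'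
  set σ' : ℕ → ℝ := fun k => Nat.casesOn k τ σ with hσ'
  have hR'n : ∀ k, ‖T - R' k‖ ≤ σ' k := by
    intro k
    cases k with
    | zero => simpa [hR', hσ'] using norm_le_traceNorm hT
    | succ k => exact (hRn k).le
  have hR'r : ∀ k, (R' k : H₂ →ₗ[ℂ] H₁).rank ≤ (2 ^ k : ℕ) := by
    intro k
    cases k with
    | zero => simp [hR']
    | succ k => exact (hRr k).trans (Nat.cast_le.2 (Nat.pow_le_pow_right (by norm_num) k.le_succ))
  set D : ℕ → H₂ →L[ℂ] H₁ := fun k => R' (k + 1) - R' k with hD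
  have hDr : ∀ k, (D k : H₂ →ₗ[ℂ] H₁).rank ≤ (2 ^ (k + 1) : ℕ) := by
    intro k
    refine (rank_sub_le _ _).trans ((add_le_add (hRr k) (hR'r k)).trans ?_)
    rw [← Nat.cast_add]
    exact Nat.cast_le.2 (by rw [pow_succ]; omega)
  have hDn : ∀ k, ‖D k‖ ≤ σ k + σ' k := by
    intro k
    have h1 : D k = (T - R' k) - (T - R' (k + 1)) := (sub_sub_sub_cancel_left _ _ _).symm
    calc ‖D k‖ = ‖(T - R' k) - (T - R' (k + 1))‖ := congrArg norm h1
      _ ≤ ‖T - R' k‖ + ‖T - R' (k + 1)‖ := norm_sub_le _ _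
      _ ≤ σ' k + σ k := add_le_add (hR'n k) (hRn k).le
      _ = σ k + σ' k := add_comm _ _
  have hσ'sum : ∀ n, ∑ k ∈ range n, (2 : ℝ) ^ k * σ' k ≤ 9 * τ := by
    intro n
    cases n with
    | zero => simp [hτ0.le]
    | succ n =>
      rw [sum_range_succ']
      have h1 : ∀ k, (2 : ℝ) ^ (k + 1) * σ' (k + 1) = 2 * (2 ^ k * σ k) := fun k => by
        simp only [hσ']
        ring
      simp only [h1]
      rw [← mul_sum]
      have h2 := hσsum n
      have h3 : σ' 0 = τ := rfl
      rw [pow_zero, one_mul, h3]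
      linarith
  have hsum : ∀ n, ∑ k ∈ range n, (2 : ℝ) ^ (k + 1) * ‖D k‖ ≤ 26 * τ := by
    intro n
    calc ∑ k ∈ range n, (2 : ℝ) ^ (k + 1) * ‖D k‖
        ≤ ∑ k ∈ range n, 2 * (2 ^ k * σ k + 2 ^ k * σ' k) := by
          refine sum_le_sum fun k _ => ?_
          rw [pow_succ, mul_comm ((2 : ℝ) ^ k), mul_assoc, ← mul_add]
          have := hDn k
          gcongr
      _ ≤ 26 * τ := by
          rw [← mul_sum, sum_add_distrib]
          have := hσsum n
          have := hσ'sum n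
          linarith
  have hsummable : Summable fun k => (2 : ℝ) ^ (k + 1) * ‖D k‖ :=
    summable_of_sum_range_le (fun k => by positivity) hsum
  have hDsum : Summable D := by
    refine Summable.of_norm_bounded hsummable fun k => ?_
    exact le_mul_of_one_le_left (norm_nonneg _) (one_le_pow₀ (by norm_num))
  have hlim : Filter.Tendsto R' Filter.atTop (nhds T) := by
    rw [tendsto_iff_norm_sub_tendsto_zero]
    have h1 : Summable fun k => (2 : ℝ) ^ k * σ' k := by
      refine summable_of_sum_range_le (fun k => ?_) hσ'sum
      exact mul_nonneg (by positivity) ((norm_nonneg _).trans (hR'n k))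
    refine squeeze_zero (fun k => norm_nonneg _) (fun k => ?_) h1.tendsto_atTop_zero
    rw [norm_sub_rev]
    exact (hR'n k).trans (le_mul_of_one_le_left ((norm_nonneg _).trans (hR'n k))
      (one_le_pow₀ (by norm_num)))
  refine ⟨D, hDr, hsum, ?_⟩
  rw [hDsum.hasSum_iff_tendsto_nat]
  have : ∀ n, ∑ k ∈ range n, D k = R' n := fun n => by
    rw [hD, sum_range_sub]
    simp [hR']
  simpa only [this] using hlim

variable [CompleteSpace H₁] [CompleteSpace H₂]

/-- Expand `D u` in an orthonormal basis of the range, padded by zeros, and move `D` to the other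
side by the adjoint. Giving every term the coefficient `‖D‖` is affordable because `rank * norm` is
summable over the dyadic pieces. -/
lemma exists_rankOne_sum_of_rank_le (D : H₂ →L[ℂ] H₁) {r : ℕ}
    (hD : (D : H₂ →ₗ[ℂ] H₁).rank ≤ r) :
    ∃ (a : Fin r → H₁) (b : Fin r → H₂), (∀ i, ‖a i‖ ≤ 1) ∧ (∀ i, ‖b i‖ ≤ 1) ∧
      D = ∑ i, ‖D‖ • rankOne ℂ (a i) (b i) := by
  set V : Submodule ℂ H₁ := LinearMap.range (D : H₂ →ₗ[ℂ] H₁) with hV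
  have hVr : Module.rank ℂ V ≤ r := hD
  have hfin : FiniteDimensional ℂ V :=
    Module.rank_lt_aleph0_iff.1 (hVr.trans_lt Cardinal.natCast_lt_aleph0)
  have hfr : Module.finrank ℂ V ≤ r := Module.finrank_le_of_rank_le hVr
  obtain ⟨k, hk⟩ := Nat.exists_eq_add_of_le hfr
  let w := stdOrthonormalBasis ℂ V
  let a : Fin (Module.finrank ℂ V + k) → H₁ := Fin.append (fun i => (w i : H₁)) fun _ => 0
  have ha : ∀ i, ‖a i‖ ≤ 1 := by
    intro i
    refine Fin.addCases (fun i => ?_) (fun i => ?_) i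
    · simp only [a, Fin.append_left]
      exact (w.orthonormal.1 i).le
    · simp [a, Fin.append_right]
  rw [hk]
  refine ⟨a, fun i => ‖D‖⁻¹ • ContinuousLinearMap.adjoint D (a i), ha, fun i => ?_, ?_⟩
  · rw [norm_smul, norm_inv, norm_norm, inv_mul_eq_div]
    refine div_le_one_of_le₀ ?_ (norm_nonneg _)
    refine ((ContinuousLinearMap.adjoint D).le_opNorm _).trans ?_
    rw [LinearIsometryEquiv.norm_map]
    exact mul_le_of_le_one_right (norm_nonneg _) (ha i)
  · rcases eq_or_ne D 0 with h0 | h0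
    · simp [h0]
    ext u
    have hn : (‖D‖ : ℂ) ≠ 0 := by
      exact_mod_cast (norm_pos_iff.2 h0).ne'
    have hDu : D u ∈ V := LinearMap.mem_range_self (D : H₂ →ₗ[ℂ] H₁) u
    have hrepr : D u = ∑ i, inner ℂ (w i : H₁) (D u) • (w i : H₁) := by
      have := congrArg (Subtype.val) (w.sum_repr' ⟨D u, hDu⟩)
      simpa using this.symm
    have hterm : ∀ i, (‖D‖ • rankOne ℂ (a i) (‖D‖⁻¹ • ContinuousLinearMap.adjoint D (a i))) u =
        inner ℂ (a i) (D u) • a i := by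
      intro i
      rw [_root_.smul_apply, rankOne_apply, ← Complex.coe_smul ‖D‖⁻¹, inner_smul_left,
        ContinuousLinearMap.adjoint_inner_left, ← Complex.coe_smul, smul_smul, Complex.conj_ofReal,
        Complex.ofReal_inv, mul_inv_cancel_left₀ hn]
    rw [_root_.sum_apply]
    simp only [hterm]
    rw [Fin.sum_univ_add]
    simpa [a] using hrepr

/-- A trace class operator is an absolutely convergent sum of operators of rank one. -/
lemma exists_hasSum_rankOne {T : H₂ →L[ℂ] H₁} (hT : IsTraceClass T) :
    ∃ (ι : Type) (_ : Countable ι) (t : ι → ℝ) (a : ι → H₁) (b : ι → H₂),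
      (∀ i, 0 ≤ t i) ∧ Summable t ∧ ∑' i, t i ≤ 26 * traceNorm T ∧
      (∀ i, ‖a i‖ ≤ 1) ∧ (∀ i, ‖b i‖ ≤ 1) ∧
      HasSum (fun i => t i • rankOne ℂ (a i) (b i)) T := by
  rcases eq_or_ne T 0 with rfl | hT0
  · exact ⟨Empty, inferInstance, fun _ => 0, fun _ => 0, fun _ => 0, fun _ => le_rfl,
      summable_empty, by simpa using traceNorm_nonneg _, by simp, by simp, hasSum_empty⟩
  obtain ⟨D, hDr, hsum, hHas⟩ := exists_hasSum_dyadic hT hT0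
  have hsummable : Summable fun k => (2 : ℝ) ^ (k + 1) * ‖D k‖ :=
    summable_of_sum_range_le (fun k => by positivity) hsum
  choose a b ha hb hab using fun k => exists_rankOne_sum_of_rank_le (D k) (hDr k)
  have htsum : ∀ k, ∑' _i : Fin (2 ^ (k + 1)), ‖D k‖ = (2 : ℝ) ^ (k + 1) * ‖D k‖ := fun k => by
    simp [tsum_fintype]
  have ht : Summable fun i : (Σ k : ℕ, Fin (2 ^ (k + 1))) => ‖D i.1‖ := by
    refine (summable_sigma_of_nonneg fun _ => norm_nonneg _).2
      ⟨fun k => Summable.of_finite, ?_⟩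
    simpa only [htsum] using hsummable
  refine ⟨Σ k : ℕ, Fin (2 ^ (k + 1)), inferInstance, fun i => ‖D i.1‖, fun i => a i.1 i.2,
    fun i => b i.1 i.2, fun i => norm_nonneg _, ht, ?_, fun i => ha _ _, fun i => hb _ _, ?_⟩
  · rw [ht.tsum_sigma' fun k => Summable.of_finite]
    simp only [htsum]
    exact Real.tsum_le_of_sum_range_le (fun k => by positivity) hsum
  · refine HasSum.sigma_of_hasSum hHas (fun k => ?_) ?_
    · have := hasSum_fintype fun i => ‖D k‖ • rankOne ℂ (a k i) (b k i)
      rwa [← hab k] at this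
    · refine Summable.of_norm_bounded ht fun i => ?_
      rw [norm_smul, norm_norm, norm_rankOne]
      exact mul_le_of_le_one_right (norm_nonneg _)
        (mul_le_one₀ (ha _ _) (norm_nonneg _) (hb _ _))

end TraceClass

/-! ### Complex measures attached to spectral measures -/

namespace SpectralMeasure

variable {H : Type*} [NormedAddCommGroup H] [InnerProductSpace ℂ H] [CompleteSpace H]
  (E : SpectralMeasure H)

/-- Additivity makes a constant series converge, so its term is zero. -/
lemma proj_empty : E.proj ∅ = 0 := by
  ext x
  have h := E.hasSum_proj (fun _ => ∅) (fun _ => .empty) (fun i j _ => disjoint_bot_left) x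
  have h1 := h.summable.tendsto_atTop_zero
  exact tendsto_nhds_unique tendsto_const_nhds h1

variable {E} in
lemma adjoint_proj {A : Set ℝ} (hA : MeasurableSet A) :
    ContinuousLinearMap.adjoint (E.proj A) = E.proj A :=
  (E.isStarProjection A hA).isSelfAdjoint.star_eq

lemma inner_proj_left {A : Set ℝ} (hA : MeasurableSet A) (x y : H) :
    inner ℂ (E.proj A x) y = inner ℂ x (E.proj A y) := by
  rw [← ContinuousLinearMap.adjoint_inner_left, adjoint_proj hA]

lemma proj_proj {A B : Set ℝ} (hA : MeasurableSet A) (hB : MeasurableSet B) (x : H) :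
    E.proj A (E.proj B x) = E.proj (A ∩ B) x := by
  rw [E.proj_inter A B hA hB]
  rfl

lemma inner_proj_eq {A : Set ℝ} (hA : MeasurableSet A) (x y : H) :
    inner ℂ x (E.proj A y) = inner ℂ (E.proj A x) (E.proj A y) := by
  rw [E.inner_proj_left hA, E.proj_proj hA hA, Set.inter_self]

lemma norm_proj_sq {A : Set ℝ} (hA : MeasurableSet A) (x : H) :
    ‖E.proj A x‖ ^ 2 = RCLike.re (inner ℂ x (E.proj A x)) := by
  rw [E.inner_proj_eq hA, inner_self_eq_norm_sq]

lemma inner_proj_of_disjoint {A B : Set ℝ} (hA : MeasurableSet A) (hB : MeasurableSet B)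
    (h : Disjoint A B) (x y : H) : inner ℂ (E.proj A x) (E.proj B y) = 0 := by
  rw [E.inner_proj_left hA, E.proj_proj hA hB, h.inter_eq, E.proj_empty]
  simp

lemma hasSum_norm_proj_sq {A : ℕ → Set ℝ} (hA : ∀ i, MeasurableSet (A i))
    (hd : Pairwise fun i j => Disjoint (A i) (A j)) (x : H) :
    HasSum (fun i => ‖E.proj (A i) x‖ ^ 2) (‖E.proj (⋃ i, A i) x‖ ^ 2) := by
  have h := ((E.hasSum_proj A hA hd x).mapL (innerSL ℂ x)).mapL Complex.reCLM
  rw [E.norm_proj_sq (.iUnion hA)]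
  simp only [E.norm_proj_sq (hA _)]
  exact h

/-- The positive measure `A ↦ ‖E(A) x‖²`. -/
def normSqMeasure (x : H) : Measure ℝ :=
  Measure.ofMeasurable (fun A _ => ENNReal.ofReal (‖E.proj A x‖ ^ 2)) (by simp [E.proj_empty])
    fun A hA hd => by
      have h := E.hasSum_norm_proj_sq hA hd x
      rw [← h.tsum_eq, ENNReal.ofReal_tsum_of_nonneg (fun _ => sq_nonneg _) h.summable]

lemma normSqMeasure_apply (x : H) {A : Set ℝ} (hA : MeasurableSet A) :
    E.normSqMeasure x A = ENNReal.ofReal (‖E.proj A x‖ ^ 2) :=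
  Measure.ofMeasurable_apply A hA

lemma normSqMeasure_univ (x : H) : E.normSqMeasure x Set.univ = ENNReal.ofReal (‖x‖ ^ 2) := by
  rw [E.normSqMeasure_apply x .univ, E.proj_univ]
  rfl

lemma sum_norm_proj_sq_le (x : H) {α : Type*} (s : Finset α) (A : α → Set ℝ)
    (hA : ∀ i ∈ s, MeasurableSet (A i)) (hd : (s : Set α).PairwiseDisjoint A) :
    ∑ i ∈ s, ‖E.proj (A i) x‖ ^ 2 ≤ ‖x‖ ^ 2 := by
  have h := (measure_biUnion_finset (μ := E.normSqMeasure x) hd hA).symm.trans_le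
    (measure_mono (Set.subset_univ _))
  rw [normSqMeasure_univ, Finset.sum_congr rfl fun i hi => E.normSqMeasure_apply x (hA i hi),
    ← ENNReal.ofReal_sum_of_nonneg fun i _ => sq_nonneg _] at h
  exact (ENNReal.ofReal_le_ofReal_iff (sq_nonneg _)).1 h

open Classical in
/-- The complex measure `A ↦ ⟪v, E(A) a⟫`. -/
def matrixMeasure (v a : H) : ComplexMeasure ℝ where
  measureOf' A := if MeasurableSet A then inner ℂ v (E.proj A a) else 0
  empty' := by simp [E.proj_empty]
  not_measurable' A hA := if_neg hA
  m_iUnion' A hA hd := by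
    simp only [hA, MeasurableSet.iUnion hA, if_true]
    exact (E.hasSum_proj A hA hd a).mapL (innerSL ℂ v)

lemma matrixMeasure_apply (v a : H) {A : Set ℝ} (hA : MeasurableSet A) :
    E.matrixMeasure v a A = inner ℂ v (E.proj A a) :=
  if_pos hA

/-- Since `⟪v, E(A) a⟫ = ⟪E(A) v, E(A) a⟫`, Cauchy-Schwarz and the inequality of means bound it by a
positive measure. -/
lemma variation_matrixMeasure_le (v a : H) :
    (E.matrixMeasure v a).variation ≤ E.normSqMeasure v + E.normSqMeasure a := by
  refine VectorMeasure.variation_le_of_forall_enorm_le fun A hA => ?_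
  rw [E.matrixMeasure_apply v a hA, Measure.add_apply, E.normSqMeasure_apply v hA,
    E.normSqMeasure_apply a hA, ← ENNReal.ofReal_add (sq_nonneg _) (sq_nonneg _),
    ← ofReal_norm]
  refine ENNReal.ofReal_le_ofReal ?_
  rw [E.inner_proj_eq hA]
  have h := norm_inner_le_norm (𝕜 := ℂ) (E.proj A v) (E.proj A a)
  nlinarith [sq_nonneg (‖E.proj A v‖ - ‖E.proj A a‖), sq_nonneg (‖E.proj A v‖),
    sq_nonneg (‖E.proj A a‖)]

lemma variation_matrixMeasure_univ_le (v a : H) :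
    (E.matrixMeasure v a).variation Set.univ ≤ ENNReal.ofReal (‖v‖ ^ 2 + ‖a‖ ^ 2) := by
  refine (E.variation_matrixMeasure_le v a Set.univ).trans_eq ?_
  rw [Measure.add_apply, normSqMeasure_univ, normSqMeasure_univ,
    ← ENNReal.ofReal_add (sq_nonneg _) (sq_nonneg _)]

instance isFiniteMeasure_variation_matrixMeasure (v a : H) :
    IsFiniteMeasure (E.matrixMeasure v a).variation :=
  ⟨(E.variation_matrixMeasure_univ_le v a).trans_lt ENNReal.ofReal_lt_top⟩

end SpectralMeasure

/-- A series of complex measures with summable total variations converges to a complex measure of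
finite variation. -/
lemma exists_complexMeasure_hasSum {X ι : Type*} [MeasurableSpace X] [Countable ι]
    (ρ : ι → ComplexMeasure X) (h : ∑' i, (ρ i).variation Set.univ ≠ ⊤) :
    ∃ μ : ComplexMeasure X, IsFiniteMeasure μ.variation ∧
      ∀ A, HasSum (fun i => ρ i A) (μ A) := by
  set m : Measure X := Measure.sum fun i => (ρ i).variation with hm
  have hfin : IsFiniteMeasure m := ⟨by
    rw [hm, Measure.sum_apply _ .univ]
    exact h.lt_top⟩
  have hle : ∀ A, ∑' i, ‖ρ i A‖ₑ ≤ m A := fun A =>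
    (ENNReal.tsum_le_tsum fun i => VectorMeasure.enorm_measure_le_variation (ρ i) A).trans
      (Measure.le_sum_apply _ A)
  have hsum : ∀ A, Summable fun i => ρ i A := fun A => by
    refine Summable.of_norm ?_
    simp only [← toReal_enorm]
    exact ENNReal.summable_toReal ((hle A).trans_lt (measure_lt_top m A)).ne
  have henorm : ∀ A, ‖∑' i, ρ i A‖ₑ ≤ m A := fun A =>
    (enorm_tsum_le_tsum_enorm).trans (hle A)
  let μ : ComplexMeasure X := VectorMeasure.of_additive_of_le_measure (μ := m)
    (fun A => ∑' i, ρ i A) henorm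
    (fun A B hA hB hd => by
      simp only [VectorMeasure.of_union hd hA hB]
      exact (hsum A).tsum_add (hsum B))
    (fun A hA => by simp [VectorMeasure.not_measurable _ hA])
  have hμ : ∀ A, μ A = ∑' i, ρ i A := fun A => rfl
  refine ⟨μ, isFiniteMeasure_of_le m
    (VectorMeasure.variation_le_of_forall_enorm_le fun A _ => by rw [hμ]; exact henorm A),
    fun A => ?_⟩
  rw [hμ]
  exact (hsum A).hasSum

/-! ### The complex measure on the plane attached to a trace class operator -/

section DoubleOperatorIntegral

open Filter InnerProductSpace

variable {H₁ H₂ : Type*} [NormedAddCommGroup H₁] [InnerProductSpace ℂ H₁] [CompleteSpace H₁]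
  [NormedAddCommGroup H₂] [InnerProductSpace ℂ H₂] [CompleteSpace H₂]
  (E₁ : SpectralMeasure H₁) (E₂ : SpectralMeasure H₂)

/-- For rank one `T` the set function on rectangles factors into a product of two complex measures.
Their total variations are bounded uniformly over the terms, so the rank one expansion can be
summed. -/
lemma exists_matrixMeasure_prod {T : H₂ →L[ℂ] H₁} (hT : IsTraceClass T) (u : H₂) (v : H₁) :
    ∃ μ : ComplexMeasure (ℝ × ℝ), IsFiniteMeasure μ.variation ∧
      ∀ A B : Set ℝ, MeasurableSet A → MeasurableSet B →
        μ (A ×ˢ B) = inner ℂ v (E₁.proj A (T (E₂.proj B u))) := by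
  obtain ⟨ι, _, t, a, b, ht0, ht, -, ha, hb, hT'⟩ := exists_hasSum_rankOne hT
  set ν : ι → ComplexMeasure (ℝ × ℝ) := fun i =>
    (E₁.matrixMeasure v (a i)).prod (E₂.matrixMeasure (b i) u) (ContinuousLinearMap.mul ℝ ℂ)
    with hν
  set C := (‖v‖ ^ 2 + 1) * (1 + ‖u‖ ^ 2) with hC
  have hνvar : ∀ i, (ν i).variation Set.univ ≤ ENNReal.ofReal C := by
    intro i
    refine (VectorMeasure.variation_prod_le Set.univ).trans ?_
    rw [Measure.smul_apply, smul_eq_mul, ← Set.univ_prod_univ, Measure.prod_prod, hC,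
      ENNReal.ofReal_mul (by positivity)]
    have h1 : ‖ContinuousLinearMap.mul ℝ ℂ‖ₑ ≤ 1 := by
      rw [← ofReal_norm, ← ENNReal.ofReal_one]
      exact ENNReal.ofReal_le_ofReal (ContinuousLinearMap.opNorm_mul_le ℝ ℂ)
    have h2 : ‖a i‖ ^ 2 ≤ 1 := pow_le_one₀ (norm_nonneg _) (ha i)
    have h3 : ‖b i‖ ^ 2 ≤ 1 := pow_le_one₀ (norm_nonneg _) (hb i)
    calc _ ≤ 1 * (ENNReal.ofReal (‖v‖ ^ 2 + ‖a i‖ ^ 2) * ENNReal.ofReal (‖b i‖ ^ 2 + ‖u‖ ^ 2)) :=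
          mul_le_mul' h1 (mul_le_mul' (E₁.variation_matrixMeasure_univ_le _ _)
            (E₂.variation_matrixMeasure_univ_le _ _))
      _ ≤ _ := by
          rw [one_mul]
          gcongr
  have hfin : ∑' i, (t i • ν i).variation Set.univ ≠ ⊤ := by
    have h1 : ∀ i, (t i • ν i).variation Set.univ ≤ ENNReal.ofReal (t i * C) := by
      intro i
      rw [VectorMeasure.variation_smul, Measure.smul_apply, ENNReal.ofReal_mul (ht0 i)]
      refine (mul_le_mul' ?_ (hνvar i) :
        (‖t i‖₊ : ENNReal) * (ν i).variation Set.univ ≤ _)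
      rw [← enorm_eq_nnnorm, ← ofReal_norm, Real.norm_of_nonneg (ht0 i)]
    refine ((ENNReal.tsum_le_tsum h1).trans_lt ?_).ne
    exact (ht.mul_right C).tsum_ofReal_lt_top
  obtain ⟨μ, hμfin, hμ⟩ := exists_complexMeasure_hasSum (fun i => t i • ν i) hfin
  refine ⟨μ, hμfin, fun A B hA hB => (hμ _).unique ?_⟩
  have h1 : HasSum (fun i => inner ℂ v (E₁.proj A ((t i • rankOne ℂ (a i) (b i)) (E₂.proj B u))))
      (inner ℂ v (E₁.proj A (T (E₂.proj B u)))) :=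
    ((hT'.mapL (ContinuousLinearMap.apply ℂ H₁ (E₂.proj B u))).mapL (E₁.proj A)).mapL
      (innerSL ℂ v)
  convert h1 using 2 with i
  rw [_root_.smul_apply, _root_.smul_apply, rankOne_apply, hν]
  simp only [VectorMeasure.prod_apply, ContinuousLinearMap.mul_apply',
    E₁.matrixMeasure_apply _ _ hA, E₂.matrixMeasure_apply _ _ hB]
  rw [← Complex.coe_smul (t i) (inner ℂ (b i) (E₂.proj B u) • a i), map_smul, map_smul,
    inner_smul_right, inner_smul_right, Complex.real_smul]
  ring

/-- Rectangles form a generating π-system, so any such measure is the one already constructed. This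
makes dominated convergence available for every measure admitted by `IsDoubleOperatorIntegral`. -/
lemma isFiniteMeasure_variation_of_prod {T : H₂ →L[ℂ] H₁} (hT : IsTraceClass T) {u : H₂} {v : H₁}
    {μ : ComplexMeasure (ℝ × ℝ)}
    (hμ : ∀ A B : Set ℝ, MeasurableSet A → MeasurableSet B →
        μ (A ×ˢ B) = inner ℂ v (E₁.proj A (T (E₂.proj B u)))) :
    IsFiniteMeasure μ.variation := by
  obtain ⟨μ', hfin, hμ'⟩ := exists_matrixMeasure_prod E₁ E₂ hT u v
  have : μ = μ' := by
    refine VectorMeasure.ext_of_generateFrom _ ?_ generateFrom_prod.symm isPiSystem_prod ?_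
    · rintro _ ⟨A, hA, B, hB, rfl⟩
      rw [hμ A B hA hB, hμ' A B hA hB]
    · rw [← Set.univ_prod_univ, hμ _ _ .univ .univ, hμ' _ _ .univ .univ]
  rwa [this]

end DoubleOperatorIntegral

/-! ### Approximation by finite sums -/

section Approximation

open Filter InnerProductSpace Topology

variable {H₁ H₂ : Type*} [NormedAddCommGroup H₁] [InnerProductSpace ℂ H₁] [CompleteSpace H₁]
  [NormedAddCommGroup H₂] [InnerProductSpace ℂ H₂] [CompleteSpace H₂]
  (E₁ : SpectralMeasure H₁) (E₂ : SpectralMeasure H₂)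

/-- The finite double operator sum attached to a simple function `φ`, which approximates the
double operator integral when `φ` approximates the identity. -/
def doubleSum (f : ℝ → ℂ) (φ : SimpleFunc ℝ ℝ) (T : H₂ →L[ℂ] H₁) : H₂ →L[ℂ] H₁ :=
  ∑ x ∈ φ.range, ∑ y ∈ φ.range,
    dividedDiff f (x, y) • (E₁.proj (φ ⁻¹' {x}) ∘L T ∘L E₂.proj (φ ⁻¹' {y}))

lemma continuous_doubleSum (f : ℝ → ℂ) (φ : SimpleFunc ℝ ℝ) :
    Continuous (doubleSum E₁ E₂ f φ) := by
  unfold doubleSum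
  fun_prop

lemma doubleSum_rankOne (f : ℝ → ℂ) (φ : SimpleFunc ℝ ℝ) (a : H₁) (b : H₂) :
    doubleSum E₁ E₂ f φ (rankOne ℂ a b) =
      kernelOp φ.range (fun x => E₁.proj (φ ⁻¹' {x}) a) (fun y => E₂.proj (φ ⁻¹' {y}) b)
        fun x y => dividedDiff f (x, y) := by
  unfold doubleSum kernelOp
  refine Finset.sum_congr rfl fun x _ => Finset.sum_congr rfl fun y _ => ?_
  rw [rankOne_comp, comp_rankOne, SpectralMeasure.adjoint_proj (φ.measurableSet_preimage _)]

lemma doubleSum_sum (f : ℝ → ℂ) (φ : SimpleFunc ℝ ℝ) {ι : Type*} (s : Finset ι)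
    (t : ι → ℝ) (T : ι → H₂ →L[ℂ] H₁) :
    doubleSum E₁ E₂ f φ (∑ k ∈ s, t k • T k) = ∑ k ∈ s, t k • doubleSum E₁ E₂ f φ (T k) := by
  ext u
  simp only [doubleSum, _root_.sum_apply, _root_.smul_apply, ContinuousLinearMap.comp_apply,
    map_sum, Finset.smul_sum, ← Complex.coe_smul, map_smul]
  symm
  rw [Finset.sum_comm]
  refine Finset.sum_congr rfl fun x _ => ?_
  rw [Finset.sum_comm]
  exact Finset.sum_congr rfl fun y _ => Finset.sum_congr rfl fun k _ => smul_comm _ _ _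

variable {f : ℝ → ℂ} {L : ℝ}

/-- Reduction to rank one: the spectral projections of the level sets of `φ` cut the two vectors
into orthogonal pieces of total squared norm at most one. The constant is `7800 = 26 * 300`. -/
lemma sum_norm_inner_doubleSum_le (hL : 0 ≤ L) (hf : ∀ x y, ‖f x - f y‖ ≤ L * |x - y|)
    (φ : SimpleFunc ℝ ℝ) {T : H₂ →L[ℂ] H₁} (hT : IsTraceClass T) {m : ℕ}
    {e : Fin m → H₁} {g : Fin m → H₂} (he : Orthonormal ℂ e) (hg : Orthonormal ℂ g) :
    ∑ i, ‖inner ℂ (e i) (doubleSum E₁ E₂ f φ T (g i))‖ ≤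
      7800 * L * traceNorm T * Real.log (1 + m) := by
  obtain ⟨ι, _, t, a, b, ht0, ht, httr, ha, hb, hT'⟩ := exists_hasSum_rankOne hT
  set B := 300 * L * Real.log (1 + m) with hB
  have hB0 : 0 ≤ B := mul_nonneg (by positivity) (Real.log_nonneg (by simp))
  have hmeas : ∀ x, MeasurableSet (φ ⁻¹' {x}) := fun x => φ.measurableSet_preimage _
  have hdisj : ∀ x y : ℝ, x ≠ y → Disjoint (φ ⁻¹' {x}) (φ ⁻¹' {y}) := fun x y hxy =>
    Disjoint.preimage _ (Set.disjoint_singleton.2 hxy)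
  have hk : ∀ k, ∑ i, ‖inner ℂ (e i)
      (doubleSum E₁ E₂ f φ (rankOne ℂ (a k) (b k)) (g i))‖ ≤ B := by
    intro k
    rw [doubleSum_rankOne]
    refine (sum_norm_inner_kernelOp_dividedDiff_le hL hf
      (fun x _ y _ hxy => E₁.inner_proj_of_disjoint (hmeas x) (hmeas y) (hdisj x y hxy) _ _)
      (fun x _ y _ hxy => E₂.inner_proj_of_disjoint (hmeas x) (hmeas y) (hdisj x y hxy) _ _)
      ?_ ?_ he hg).trans_eq (by rw [hB, Fintype.card_fin])
    · exact (E₁.sum_norm_proj_sq_le _ _ _ (fun x _ => hmeas x)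
        fun x _ y _ hxy => hdisj x y hxy).trans (pow_le_one₀ (norm_nonneg _) (ha k))
    · exact (E₂.sum_norm_proj_sq_le _ _ _ (fun x _ => hmeas x)
        fun x _ y _ hxy => hdisj x y hxy).trans (pow_le_one₀ (norm_nonneg _) (hb k))
  have hcont : Continuous fun S : H₂ →L[ℂ] H₁ =>
      ∑ i, ‖inner ℂ (e i) (doubleSum E₁ E₂ f φ S (g i))‖ := by
    have := continuous_doubleSum E₁ E₂ f φ
    fun_prop
  have hlim : Tendsto (fun s : Finset ι => ∑ i, ‖inner ℂ (e i) (doubleSum E₁ E₂ f φ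
      (∑ k ∈ s, t k • rankOne ℂ (a k) (b k)) (g i))‖) atTop
      (𝓝 (∑ i, ‖inner ℂ (e i) (doubleSum E₁ E₂ f φ T (g i))‖)) :=
    (hcont.tendsto T).comp hT'
  have hpart : ∀ s : Finset ι, ∑ i, ‖inner ℂ (e i) (doubleSum E₁ E₂ f φ
      (∑ k ∈ s, t k • rankOne ℂ (a k) (b k)) (g i))‖ ≤ (∑' k, t k) * B := by
    intro s
    rw [doubleSum_sum]
    calc _ ≤ ∑ i, ∑ k ∈ s, t k * ‖inner ℂ (e i)
          (doubleSum E₁ E₂ f φ (rankOne ℂ (a k) (b k)) (g i))‖ := by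
          refine Finset.sum_le_sum fun i _ => ?_
          rw [_root_.sum_apply, inner_sum]
          refine (norm_sum_le _ _).trans_eq (Finset.sum_congr rfl fun k _ => ?_)
          rw [_root_.smul_apply, ← Complex.coe_smul, inner_smul_right, norm_mul,
            Complex.norm_real, Real.norm_of_nonneg (ht0 k)]
      _ = ∑ k ∈ s, t k * ∑ i, ‖inner ℂ (e i)
          (doubleSum E₁ E₂ f φ (rankOne ℂ (a k) (b k)) (g i))‖ := by
          rw [Finset.sum_comm]
          exact Finset.sum_congr rfl fun k _ => (Finset.mul_sum _ _ _).symm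
      _ ≤ ∑ k ∈ s, t k * B :=
          Finset.sum_le_sum fun k _ => mul_le_mul_of_nonneg_left (hk k) (ht0 k)
      _ = (∑ k ∈ s, t k) * B := (Finset.sum_mul _ _ _).symm
      _ ≤ (∑' k, t k) * B :=
          mul_le_mul_of_nonneg_right (ht.sum_le_tsum _ fun k _ => ht0 k) hB0
  refine (le_of_tendsto hlim (Eventually.of_forall hpart)).trans ?_
  refine (mul_le_mul_of_nonneg_right httr hB0).trans_eq ?_
  rw [hB]
  ring

lemma orthonormal_normalize {H : Type*} [NormedAddCommGroup H] [InnerProductSpace ℂ H] {w : H}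
    (hw : w ≠ 0) : Orthonormal ℂ fun _ : Fin 1 => ((‖w‖ : ℂ)⁻¹) • w :=
  ⟨fun _ => norm_smul_inv_norm hw, Subsingleton.pairwise⟩

/-- Families of length one turn the matrix sum bound into an operator norm bound uniform in `φ`. -/
lemma norm_inner_doubleSum_le (hL : 0 ≤ L) (hf : ∀ x y, ‖f x - f y‖ ≤ L * |x - y|)
    (φ : SimpleFunc ℝ ℝ) {T : H₂ →L[ℂ] H₁} (hT : IsTraceClass T) (u : H₂) (v : H₁) :
    ‖inner ℂ v (doubleSum E₁ E₂ f φ T u)‖ ≤ 7800 * L * traceNorm T * Real.log 2 * ‖u‖ * ‖v‖ := by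
  rcases eq_or_ne u 0 with rfl | hu
  · simp
  rcases eq_or_ne v 0 with rfl | hv
  · simp
  have h := sum_norm_inner_doubleSum_le E₁ E₂ hL hf φ hT (orthonormal_normalize hv)
    (orthonormal_normalize hu)
  rw [Fin.sum_univ_one, map_smul, inner_smul_left, inner_smul_right, norm_mul, norm_mul,
    RCLike.norm_conj, norm_inv, norm_inv, Complex.norm_real, Complex.norm_real, norm_norm,
    norm_norm, inv_mul_le_iff₀ (norm_pos_iff.2 hv), inv_mul_le_iff₀ (norm_pos_iff.2 hu),
    Nat.cast_one, one_add_one_eq_two] at h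
  exact h.trans_eq (by ring)

lemma measurable_dividedDiff (hf : Measurable f) : Measurable (dividedDiff f) := by
  unfold dividedDiff
  refine Measurable.ite (measurableSet_eq_fun measurable_fst measurable_snd) measurable_const ?_
  fun_prop

lemma integral_dividedDiff_simpleFunc (f : ℝ → ℂ) (φ : SimpleFunc ℝ ℝ) {T : H₂ →L[ℂ] H₁}
    {u : H₂} {v : H₁} (μ : ComplexMeasure (ℝ × ℝ)) [IsFiniteMeasure μ.variation]
    (hμ : ∀ A B : Set ℝ, MeasurableSet A → MeasurableSet B →
        μ (A ×ˢ B) = inner ℂ v (E₁.proj A (T (E₂.proj B u)))) :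
    VectorMeasure.integral μ (fun z => dividedDiff f (φ z.1, φ z.2))
      (ContinuousLinearMap.mul ℝ ℂ) = inner ℂ v (doubleSum E₁ E₂ f φ T u) := by
  have hmeas : ∀ x, MeasurableSet (φ ⁻¹' {x}) := fun x => φ.measurableSet_preimage _
  have hfun : (fun z : ℝ × ℝ => dividedDiff f (φ z.1, φ z.2)) = fun z =>
      ∑ x ∈ φ.range, ∑ y ∈ φ.range,
        ((φ ⁻¹' {x}) ×ˢ (φ ⁻¹' {y})).indicator (fun _ => dividedDiff f (x, y)) z := by
    ext z
    rw [Finset.sum_eq_single_of_mem (φ z.1) (φ.mem_range_self _) ?_,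
      Finset.sum_eq_single_of_mem (φ z.2) (φ.mem_range_self _) ?_]
    · simp
    · intro y _ hy
      exact Set.indicator_of_notMem (fun h => hy h.2.symm) _
    · intro x _ hx
      exact Finset.sum_eq_zero fun y _ => Set.indicator_of_notMem (fun h => hx h.1.symm) _
  have hint : ∀ x y, μ.Integrable
      (((φ ⁻¹' {x}) ×ˢ (φ ⁻¹' {y})).indicator fun _ : ℝ × ℝ => dividedDiff f (x, y)) :=
    fun x y => (integrable_const _).indicator ((hmeas x).prod (hmeas y))
  rw [hfun, VectorMeasure.integral_finsetSum _ fun x _ =>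
    MeasureTheory.integrable_finsetSum _ fun y _ => hint x y]
  simp only [doubleSum, _root_.sum_apply, inner_sum]
  refine Finset.sum_congr rfl fun x _ => ?_
  rw [VectorMeasure.integral_finsetSum _ fun y _ => hint x y]
  refine Finset.sum_congr rfl fun y _ => ?_
  rw [VectorMeasure.integral_indicator_const _ ((hmeas x).prod (hmeas y)),
    hμ _ _ (hmeas x) (hmeas y), _root_.smul_apply, inner_smul_right]
  rfl

/-- The diagonal causes no trouble because the same approximation acts on both variables: diagonal
points stay on the diagonal, where the kernel is 0. -/
lemma tendsto_dividedDiff (hf : Continuous f) {φ : ℕ → ℝ → ℝ}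
    (hφ : ∀ x, Tendsto (fun n => φ n x) atTop (𝓝 x)) (z : ℝ × ℝ) :
    Tendsto (fun n => dividedDiff f (φ n z.1, φ n z.2)) atTop (𝓝 (dividedDiff f z)) := by
  obtain ⟨x, y⟩ := z
  rcases eq_or_ne x y with rfl | hxy
  · simp only [dividedDiff_self]
    exact tendsto_const_nhds
  · have hne : ∀ᶠ n in atTop, φ n x ≠ φ n y :=
      (((hφ x).sub (hφ y)).eventually_ne (sub_ne_zero.2 hxy)).mono fun n hn => sub_ne_zero.1 hn
    rw [dividedDiff_of_ne f hxy]
    refine Tendsto.congr' (f₁ := fun n => (f (φ n x) - f (φ n y)) / ((φ n x - φ n y : ℝ) : ℂ))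
      (hne.mono fun n hn => (dividedDiff_of_ne f hn).symm) ?_
    refine Tendsto.div (((hf.tendsto x).comp (hφ x)).sub ((hf.tendsto y).comp (hφ y)))
      ((Complex.continuous_ofReal.tendsto _).comp ((hφ x).sub (hφ y))) ?_
    exact_mod_cast sub_ne_zero.2 hxy

/-- Simple functions converging pointwise to the identity of `ℝ`. -/
def approxId (n : ℕ) : SimpleFunc ℝ ℝ :=
  (stronglyMeasurable_id (α := ℝ)).approx n

lemma tendsto_approxId (x : ℝ) : Tendsto (fun n => approxId n x) atTop (𝓝 x) :=
  (stronglyMeasurable_id (α := ℝ)).tendsto_approx x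

lemma tendsto_inner_doubleSum (hL : 0 ≤ L) (hf : ∀ x y, ‖f x - f y‖ ≤ L * |x - y|)
    (hfc : Continuous f) {T : H₂ →L[ℂ] H₁} {u : H₂} {v : H₁} (μ : ComplexMeasure (ℝ × ℝ))
    [IsFiniteMeasure μ.variation]
    (hμ : ∀ A B : Set ℝ, MeasurableSet A → MeasurableSet B →
        μ (A ×ˢ B) = inner ℂ v (E₁.proj A (T (E₂.proj B u)))) :
    Tendsto (fun n => inner ℂ v (doubleSum E₁ E₂ f (approxId n) T u)) atTop
      (𝓝 (VectorMeasure.integral μ (dividedDiff f) (ContinuousLinearMap.mul ℝ ℂ))) := by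
  simp only [← integral_dividedDiff_simpleFunc E₁ E₂ f _ μ hμ]
  refine VectorMeasure.tendsto_integral_filter_of_norm_le_const
    (Eventually.of_forall fun n => ?_) ⟨L, Eventually.of_forall fun n =>
      Eventually.of_forall fun z => norm_dividedDiff_le hL hf _ _⟩
    (Eventually.of_forall fun z => tendsto_dividedDiff hfc tendsto_approxId z)
  exact ((measurable_dividedDiff hfc.measurable).comp
    (((approxId n).measurable.comp measurable_fst).prodMk
      ((approxId n).measurable.comp measurable_snd))).aestronglyMeasurable

/-- A bounded sequence of operators whose matrix elements converge has a weak limit. -/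
lemma exists_weak_limit (Q : ℕ → H₂ →L[ℂ] H₁) {B : ℝ} (hB : 0 ≤ B)
    (hQ : ∀ n u v, ‖inner ℂ v (Q n u)‖ ≤ B * ‖u‖ * ‖v‖) (ℓ : H₂ → H₁ → ℂ)
    (hℓ : ∀ u v, Tendsto (fun n => inner ℂ v (Q n u)) atTop (𝓝 (ℓ u v))) :
    ∃ Q' : H₂ →L[ℂ] H₁, ∀ u v, inner ℂ v (Q' u) = ℓ u v := by
  have hbound : ∀ u v, ‖ℓ u v‖ ≤ B * ‖u‖ * ‖v‖ := fun u v =>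
    le_of_tendsto (hℓ u v).norm (Eventually.of_forall fun n => hQ n u v)
  have hadd_right : ∀ u v w, ℓ u (v + w) = ℓ u v + ℓ u w := fun u v w => by
    refine tendsto_nhds_unique (hℓ u (v + w)) ?_
    simp only [inner_add_left]
    exact (hℓ u v).add (hℓ u w)
  have hsmul_right : ∀ (c : ℂ) u v, ℓ u (c • v) = starRingEnd ℂ c * ℓ u v := fun c u v => by
    refine tendsto_nhds_unique (hℓ u (c • v)) ?_
    simp only [inner_smul_left]
    exact (hℓ u v).const_mul _
  have hadd_left : ∀ u u' v, ℓ (u + u') v = ℓ u v + ℓ u' v := fun u u' v => by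
    refine tendsto_nhds_unique (hℓ (u + u') v) ?_
    simp only [map_add, inner_add_right]
    exact (hℓ u v).add (hℓ u' v)
  have hsmul_left : ∀ (c : ℂ) u v, ℓ (c • u) v = c * ℓ u v := fun c u v => by
    refine tendsto_nhds_unique (hℓ (c • u) v) ?_
    simp only [map_smul, inner_smul_right]
    exact (hℓ u v).const_mul _
  let G : H₂ → StrongDual ℂ H₁ := fun u => LinearMap.mkContinuous
    { toFun := fun v => starRingEnd ℂ (ℓ u v)
      map_add' := fun v w => by rw [hadd_right, map_add]
      map_smul' := fun c v => by simp [hsmul_right] }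
    (B * ‖u‖) fun v => by
      change ‖starRingEnd ℂ (ℓ u v)‖ ≤ _
      rw [RCLike.norm_conj]
      exact hbound u v
  let q : H₂ → H₁ := fun u => (toDual ℂ H₁).symm (G u)
  have hq : ∀ u v, inner ℂ v (q u) = ℓ u v := fun u v => by
    rw [← inner_conj_symm, toDual_symm_apply]
    exact Complex.conj_conj _
  refine ⟨LinearMap.mkContinuous
    { toFun := q
      map_add' := fun u u' => ext_inner_left ℂ fun v => by
        rw [inner_add_right, hq, hq, hq, hadd_left]
      map_smul' := fun c u => ext_inner_left ℂ fun v => by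
        rw [RingHom.id_apply, inner_smul_right, hq, hq, hsmul_left] } B fun u => ?_, hq⟩
  change ‖(toDual ℂ H₁).symm (G u)‖ ≤ _
  rw [LinearIsometryEquiv.norm_map]
  exact LinearMap.mkContinuous_norm_le _ (by positivity) _

end Approximation

/-! ### The main theorem -/

lemma norm_sub_le_lipNorm {f : ℝ → ℂ} (hf : ∃ K : NNReal, LipschitzWith K f) (x y : ℝ) :
    ‖f x - f y‖ ≤ lipNorm f * |x - y| := by
  obtain ⟨K, hK⟩ := hf
  have hb : ∀ x y, ‖f x - f y‖ ≤ K * |x - y| := fun x y => by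
    simpa [dist_eq_norm] using hK.dist_le_mul x y
  rcases eq_or_ne x y with rfl | hxy
  · simp
  rw [← div_le_iff₀ (abs_pos.2 (sub_ne_zero.2 hxy))]
  refine le_ciSup (f := fun p : {p : ℝ × ℝ // p.1 ≠ p.2} =>
    ‖f p.1.1 - f p.1.2‖ / |p.1.1 - p.1.2|) ⟨K, ?_⟩ ⟨(x, y), hxy⟩
  rintro _ ⟨p, rfl⟩
  exact div_le_of_le_mul₀ (abs_nonneg _) K.2 (hb _ _)

lemma lipNorm_nonneg (f : ℝ → ℂ) : 0 ≤ lipNorm f :=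
  Real.iSup_nonneg fun _ => by positivity

end LipschitzDOI

end

theorem mainTheorem4 : ∃ C : ℝ,
    ∀ (H₁ : Type*) (H₂ : Type*)
      [NormedAddCommGroup H₁] [InnerProductSpace ℂ H₁] [CompleteSpace H₁]
      [NormedAddCommGroup H₂] [InnerProductSpace ℂ H₂] [CompleteSpace H₂]
      (E₁ : LipschitzDOI.SpectralMeasure H₁) (E₂ : LipschitzDOI.SpectralMeasure H₂)
      (f : ℝ → ℂ) (hf : ∃ K : NNReal, LipschitzWith K f)
      (T : H₂ →L[ℂ] H₁) (hT : LipschitzDOI.IsTraceClass T),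
      (∃! Q : H₂ →L[ℂ] H₁,
        LipschitzDOI.IsDoubleOperatorIntegral E₁ E₂ (LipschitzDOI.dividedDiff f) T Q) ∧
      ∀ Q : H₂ →L[ℂ] H₁,
        LipschitzDOI.IsDoubleOperatorIntegral E₁ E₂ (LipschitzDOI.dividedDiff f) T Q →
          LipschitzDOI.MemSOmega Q ∧
          LipschitzDOI.sOmegaNorm Q ≤
            C * LipschitzDOI.lipNorm f * LipschitzDOI.traceNorm T := by
  -- `4 * 7800`, from `sum_singularValue_le_of_forall` and `sum_norm_inner_doubleSum_le`.
  refine ⟨31200, ?_⟩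
  intro H₁ H₂ _ _ _ _ _ _ E₁ E₂ f hf T hT
  have hL := LipschitzDOI.lipNorm_nonneg f
  have hfL := LipschitzDOI.norm_sub_le_lipNorm hf
  have hfc : Continuous f := by
    obtain ⟨K, hK⟩ := hf
    exact hK.continuous
  have htr := LipschitzDOI.traceNorm_nonneg T
  -- The approximating sums do not depend on `Q`, so this gives uniqueness and also carries the
  -- matrix sum bounds over to `Q`.
  have hlim : ∀ Q : H₂ →L[ℂ] H₁,
      LipschitzDOI.IsDoubleOperatorIntegral E₁ E₂ (LipschitzDOI.dividedDiff f) T Q →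
      ∀ u v, Filter.Tendsto (fun n => inner ℂ v
        (LipschitzDOI.doubleSum E₁ E₂ f (LipschitzDOI.approxId n) T u)) Filter.atTop
        (nhds (inner ℂ v (Q u))) := by
    intro Q hQ u v
    obtain ⟨μ, hμ, -, hQμ⟩ := hQ u v
    have := LipschitzDOI.isFiniteMeasure_variation_of_prod E₁ E₂ hT hμ
    rw [hQμ]
    exact LipschitzDOI.tendsto_inner_doubleSum E₁ E₂ hL hfL hfc μ hμ
  refine ⟨?_, fun Q hQ => ?_⟩
  · choose μ hμfin hμ using LipschitzDOI.exists_matrixMeasure_prod E₁ E₂ hT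
    obtain ⟨Q, hQ⟩ := LipschitzDOI.exists_weak_limit
      (fun n => LipschitzDOI.doubleSum E₁ E₂ f (LipschitzDOI.approxId n) T)
      (by positivity : 0 ≤ 7800 * LipschitzDOI.lipNorm f * LipschitzDOI.traceNorm T * Real.log 2)
      (fun n u v => LipschitzDOI.norm_inner_doubleSum_le E₁ E₂ hL hfL _ hT u v) _
      (fun u v => LipschitzDOI.tendsto_inner_doubleSum E₁ E₂ hL hfL hfc (μ u v) (hμ u v))
    refine ⟨Q, fun u v => ⟨μ u v, hμ u v, ?_, hQ u v⟩, fun Q' hQ' => ?_⟩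
    · exact Integrable.of_bound
        (LipschitzDOI.measurable_dividedDiff hfc.measurable).aestronglyMeasurable
        (LipschitzDOI.lipNorm f)
        (Filter.Eventually.of_forall fun z => LipschitzDOI.norm_dividedDiff_le hL hfL z.1 z.2)
    · ext u
      refine ext_inner_left ℂ fun v => tendsto_nhds_unique (hlim Q' hQ' u v) ?_
      rw [hQ]
      exact LipschitzDOI.tendsto_inner_doubleSum E₁ E₂ hL hfL hfc (μ u v) (hμ u v)
  · have hmean : ∀ n, LipschitzDOI.logMean Q n ≤
        31200 * LipschitzDOI.lipNorm f * LipschitzDOI.traceNorm T := by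
      intro n
      have hlog : 0 < Real.log (2 + n) := Real.log_pos (by
        have : (0 : ℝ) ≤ n := n.cast_nonneg
        linarith)
      rw [LipschitzDOI.logMean, inv_mul_le_iff₀ hlog]
      refine (LipschitzDOI.sum_singularValue_le_of_forall Q (n + 1)
        (B := 7800 * LipschitzDOI.lipNorm f * LipschitzDOI.traceNorm T * Real.log (2 + n))
        fun m hm e g he hg => ?_).trans_eq (by ring)
      have ht : Filter.Tendsto (fun k => ∑ i, ‖inner ℂ (e i)
          (LipschitzDOI.doubleSum E₁ E₂ f (LipschitzDOI.approxId k) T (g i))‖) Filter.atTop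
          (nhds (∑ i, ‖inner ℂ (e i) (Q (g i))‖)) :=
        tendsto_finsetSum _ fun i _ => (hlim Q hQ (g i) (e i)).norm
      refine le_of_tendsto ht (Filter.Eventually.of_forall fun k => ?_)
      refine (LipschitzDOI.sum_norm_inner_doubleSum_le E₁ E₂ hL hfL _ hT he hg).trans ?_
      -- The sum over `j ≤ n` has `n + 1` terms, so `log (1 + m)` is at most the normalising `log (2
      -- + n)`.
      have hm' : (m : ℝ) ≤ n + 1 := by exact_mod_cast hm
      have : Real.log (1 + m) ≤ Real.log (2 + n) :=
        Real.log_le_log (by positivity) (by linarith)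
      gcongr
    refine ⟨⟨31200 * LipschitzDOI.lipNorm f * LipschitzDOI.traceNorm T, ?_⟩, ciSup_le hmean⟩
    rintro _ ⟨n, rfl⟩
    exact hmean n
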